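/- A \emph{stochastic graph} consists of $n\ge 1$ nodes $v_1,\dots,v_n$, a finite metric space $(\{s_1,\dots,s_m\},\mathrm d)$ with rational distances, and, for every node $v$, a probability distribution $(p_{vs})_s$ with rational probabilities on the $m$ points. The nodes are placed at random, independently of each other, node $v$ at point $s$ with probability $p_{vs}$ (the locational uncertainty model). For a realization $r=(r_1,\dots,r_n)$, in which node $v_i$ is located at the point $r_i$, let $\mathsf{MST}(r)$ be the length of a minimum spanning tree of the complete graph on the nodes, in which the edge $v_iv_j$ has length $\mathrm d(r_i,r_j)$, and let $$\mathbb E[\mathsf{MST}]=\sum_{r}\Bigl(\prod_{i=1}^n p_{v_i r_i}\Bigr)\,\mathsf{MST}(r).$$ \textbf{Theorem.} There is a fully polynomial randomized approximation scheme (FPRAS) for $\mathbb E[\mathsf{MST}]$. That is, there is a single randomized algorithm $A$, with fair coin tosses as its source of randomness, which takes as input a stochastic graph $\mathcal G$ (the numbers $n$ and $m$, the distance matrix and the matrix of the $p_{vs}$, all in binary) and a rational number $\epsilon>0$, and returns a rational number $A(\mathcal G,\epsilon)$ such that $$\Pr\bigl[(1-\epsilon)\,\mathbb E[\mathsf{MST}]\le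 A(\mathcal G,\epsilon)\le(1+\epsilon)\,\mathbb E[\mathsf{MST}]\bigr]\ \ge\ \tfrac34 ,$$ and whose running time, for every outcome of the coin tosses, is bounded by a polynomial in the binary length of the input $(\mathcal G,\epsilon)$ and in $1/\epsilon$. Running time is measured as bit cost on a random access machine (logarithmic cost criterion). -/

import Mathlib

open scoped ENNReal

/-! ## The computation model

A randomized random access machine with logarithmic (bit) cost, programmed in a structured
language.  A cell holds a rational number; memory is organised in named arrays, array names are
constants of the program and indices are computed at run time.  The cost of an evaluation is the
total binary length of all values that occur in it, and the only source of randomness is a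
fair coin. -/

/-- The binary length of a rational number: sign, numerator and denominator in lowest terms. -/
def bitLength (q : ℚ) : ℕ := 1 + q.num.natAbs.size + q.den.size

/-- The memory: the contents of cell `i` of array `a` is `σ a i`. -/
abbrev Memory : Type := ℕ → ℕ → ℚ

/-- Arithmetic expressions; `get a e` reads the cell of array `a` whose index is the
value of `e` (rounded down). -/
inductive Expr : Type
  | const (q : ℚ)
  | get (a : ℕ) (e : Expr)
  | add (e₁ e₂ : Expr)
  | sub (e₁ e₂ : Expr)
  | mul (e₁ e₂ : Expr)
  | div (e₁ e₂ : Expr)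

/-- The value of an expression; division by zero yields `0`. -/
def Expr.eval : Expr → Memory → ℚ
  | .const q, _ => q
  | .get a e, σ => σ a ⌊e.eval σ⌋₊
  | .add e₁ e₂, σ => e₁.eval σ + e₂.eval σ
  | .sub e₁ e₂, σ => e₁.eval σ - e₂.eval σ
  | .mul e₁ e₂, σ => e₁.eval σ * e₂.eval σ
  | .div e₁ e₂, σ => e₁.eval σ / e₂.eval σ

/-- The cost of evaluating an expression: the sum of the binary lengths of the values of all
its subexpressions (itself included). -/
def Expr.cost : Expr → Memory → ℕ
  | .const q, _ => bitLength q
  | .get a e, σ => bitLength ((Expr.get a e).eval σ) + e.cost σ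
  | .add e₁ e₂, σ => bitLength ((Expr.add e₁ e₂).eval σ) + e₁.cost σ + e₂.cost σ
  | .sub e₁ e₂, σ => bitLength ((Expr.sub e₁ e₂).eval σ) + e₁.cost σ + e₂.cost σ
  | .mul e₁ e₂, σ => bitLength ((Expr.mul e₁ e₂).eval σ) + e₁.cost σ + e₂.cost σ
  | .div e₁ e₂, σ => bitLength ((Expr.div e₁ e₂).eval σ) + e₁.cost σ + e₂.cost σ

/-- Programs.
* `set a i e` : store the value of `e` in cell `i` of array `a`;
* `flip a i` : toss a fair coin and store the outcome, `0` or `1`, in cell `i` of array `a`;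
* `seq c₁ c₂` : run `c₁`, then `c₂`;
* `ite e₁ e₂ c₁ c₂` : run `c₁` if `e₁ ≤ e₂`, otherwise run `c₂`;
* `loop e c` : run `c` repeatedly; the number of rounds is the value of `e` (rounded down)
  on entry.

Hence every program halts. -/
inductive Program : Type
  | set (a : ℕ) (i e : Expr)
  | flip (a : ℕ) (i : Expr)
  | seq (c₁ c₂ : Program)
  | ite (e₁ e₂ : Expr) (c₁ c₂ : Program)
  | loop (e : Expr) (c : Program)

/-- Overwrite cell `i` of array `a`. -/
def Memory.write (σ : Memory) (a i : ℕ) (q : ℚ) : Memory :=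
  Function.update σ a (Function.update (σ a) i q)

/-- Run `f` (which returns the new memory and the time used) `k` times in succession, adding up
the times, plus one step per round. -/
noncomputable def iterate (f : Memory → PMF (Memory × ℕ)) : ℕ → Memory → PMF (Memory × ℕ)
  | 0, σ => PMF.pure (σ, 0)
  | k + 1, σ => (f σ).bind fun x => (iterate f k x.1).map fun y => (y.1, x.2 + y.2 + 1)

/-- The joint distribution of the final memory and of the running time of a program that is
started on the memory `σ`. -/
noncomputable def Program.run : Program → Memory → PMF (Memory × ℕ)
  | .set a i e, σ =>
      PMF.pure (σ.write a ⌊i.eval σ⌋₊ (e.eval σ), 1 + i.cost σ + e.cost σ)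
  | .flip a i, σ =>
      (PMF.uniformOfFintype Bool).map fun b =>
        (σ.write a ⌊i.eval σ⌋₊ (if b then 1 else 0), 1 + i.cost σ)
  | .seq c₁ c₂, σ =>
      (c₁.run σ).bind fun x => (c₂.run x.1).map fun y => (y.1, x.2 + y.2)
  | .ite e₁ e₂ c₁ c₂, σ =>
      (if e₁.eval σ ≤ e₂.eval σ then c₁.run σ else c₂.run σ).map fun x =>
        (x.1, 1 + e₁.cost σ + e₂.cost σ + x.2)
  | .loop e c, σ =>
      (iterate c.run ⌊e.eval σ⌋₊ σ).map fun x => (x.1, 1 + e.cost σ + x.2)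

/-- `A` is a fully polynomial randomized approximation scheme for the quantity `f`, where an
instance `x` with error parameter `ε` is presented as the initial memory `load x ε`, the binary
length of `x` is `size x`, and the answer is found in cell `0` of array `3`:
for every instance `x` and every rational `ε > 0`, the answer lies in
`[(1 - ε) f x, (1 + ε) f x]` with probability at least `3/4`, and the running time, whatever the
outcomes of the coin tosses, is polynomial in the binary length of the input `(x, ε)` and
in `1 / ε`. -/
def IsFPRAS {α : Type} (load : α → ℚ → Memory) (size : α → ℕ) (f : α → ℝ) (A : Program) : Prop :=
  (∀ (x : α) (ε : ℚ), 0 < ε →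
    (3 / 4 : ℝ≥0∞) ≤ (A.run (load x ε)).toOuterMeasure
      {z | (1 - (ε : ℝ)) * f x ≤ (z.1 3 0 : ℝ) ∧ (z.1 3 0 : ℝ) ≤ (1 + (ε : ℝ)) * f x}) ∧
  ∃ C k : ℕ, ∀ (x : α) (ε : ℚ), 0 < ε → ∀ z ∈ (A.run (load x ε)).support,
    (z.2 : ℝ) ≤ C * ((size x : ℝ) + bitLength ε + 1 / (ε : ℝ)) ^ k

/-! ## Stochastic graphs -/

/-- A stochastic graph (locational uncertainty model): `n ≥ 1` nodes, a metric space of `m`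
points, and for every node `v` a probability distribution `prob v` of its location. -/
structure StochasticGraph where
  n : ℕ
  m : ℕ
  n_pos : 0 < n
  dist : Fin m → Fin m → ℚ
  dist_eq_zero : ∀ s t, dist s t = 0 ↔ s = t
  dist_comm : ∀ s t, dist s t = dist t s
  dist_triangle : ∀ s t u, dist s u ≤ dist s t + dist t u
  prob : Fin n → Fin m → ℚ
  prob_nonneg : ∀ v s, 0 ≤ prob v s
  prob_sum : ∀ v, ∑ s, prob v s = 1

namespace StochasticGraph

/-- The distance between the endpoints of an edge (an unordered pair of nodes) when every node
`v` is located at the point `r v`. -/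
def edgeLength (G : StochasticGraph) (r : Fin G.n → Fin G.m) : Sym2 (Fin G.n) → ℚ :=
  Sym2.lift ⟨fun u v => G.dist (r u) (r v), fun _ _ => G.dist_comm _ _⟩

open Classical in
/-- The length of the minimum spanning tree on the nodes under the realization `r`: the minimum
over all trees `T` on the node set (a finite, nonempty family) of the total length of `T`. -/
noncomputable def mst (G : StochasticGraph) (r : Fin G.n → Fin G.m) : ℝ :=
  ⨅ T : {T : SimpleGraph (Fin G.n) // T.IsTree}, ∑ e ∈ T.1.edgeFinset, (G.edgeLength r e : ℝ)

/-- The expected length of the minimum spanning tree, the locations of the nodes being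
independent. -/
noncomputable def expectedMST (G : StochasticGraph) : ℝ :=
  ∑ r : Fin G.n → Fin G.m, (∏ v, (G.prob v (r v) : ℝ)) * G.mst r

/-- The binary length of a stochastic graph, presented by `n`, `m`, the distance matrix and the
matrix of the location probabilities. -/
def size (G : StochasticGraph) : ℕ :=
  bitLength G.n + bitLength G.m + ∑ s, ∑ t, bitLength (G.dist s t) +
    ∑ v, ∑ s, bitLength (G.prob v s)

/-- The list of the entries of a matrix, row after row, as the contents of an array: the entry
`(i, j)` is in cell `i * b + j`, all other cells hold `0`. -/
def rowMajor {a b : ℕ} (M : Fin a → Fin b → ℚ) (k : ℕ) : ℚ :=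
  if h : k < a * b then
    M (finProdFinEquiv.symm ⟨k, h⟩).1 (finProdFinEquiv.symm ⟨k, h⟩).2
  else 0

/-- The initial memory for the input `(G, ε)`: array `0` holds `n`, `m` and `ε`, array `1` the
distance matrix and array `2` the matrix of the location probabilities. All other cells
hold `0`. -/
def load (G : StochasticGraph) (ε : ℚ) : Memory
  | 0, 0 => G.n
  | 0, 1 => G.m
  | 0, 2 => ε
  | 1, k => rowMajor G.dist k
  | 2, k => rowMajor G.prob k
  | _, _ => 0

end StochasticGraph

/-!
Fix a root node and let the *star* be the tree that joins the root to all other nodes.  By the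
triangle inequality the star of a realization is at most `n` times as long as its minimum spanning
tree, so the quotient of the two lengths lies between `1 / n` and `1` (or both lengths vanish).
The expected length of the star is a sum over the other nodes `j` and over the locations `s`, `t` of
the root and of `j`, so weighting a realization with the length of its star amounts to choosing
`j`, `s`, `t` with a weight known in closed form and drawing the other nodes from their own
distributions.  Hence `E[MST]` is the expectation, over a realization `r`, of
`∑ p(root, s) * p(j, t) * d(s, t) * (MST / star)`, where the quotient is taken after
relocating the root to `s` and `j` to `t` in `r` (`expectedMST_eq_sum_weightedSum`).  This
random variable is nonnegative, its maximum `W` is at most `n * E[MST]`, and so by Chebyshev's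
inequality the average of about `8 n² / ε²` samples is accurate (`card_accurate_le`).

A location is drawn by inverting the distribution function at a random dyadic number.  The number of
bits depends on `n`, `m`, `1 / ε` only, and the bias this causes is bounded by counting grid points
(`abs_sum_select_pi_sub_le`).  The lengths of minimum spanning trees are computed by Prim's
algorithm, whose invariant `PrimInv` avoids exchange arguments: a shortest edge that
leaves the set reached is paid for by an edge of an arbitrary tree that is no longer needed.

The running time is bounded by a syntactic criterion (`Program.exists_polyBounded_time`): the
numbers of rounds of all loops are functions of the input, and the arrays have levels such that a
cell is only combined with cells of smaller level when it is updated.  Then the heights of all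
numbers grow polynomially with the number of assignments.
-/


/-! ### Heights of rational numbers -/

/-- The height of a rational number: the larger one of the binary lengths of its numerator and
denominator.  Unlike `bitLength` it is subadditive (up to `1`) under all four operations. -/
def height (q : ℚ) : ℕ := max q.num.natAbs.size q.den.size

theorem height_le_iff {q : ℚ} {h : ℕ} : height q ≤ h ↔ q.num.natAbs < 2 ^ h ∧ q.den < 2 ^ h := by
  simp [height, Nat.size_le]

theorem height_pos (q : ℚ) : 1 ≤ height q :=
  le_max_of_le_right (Nat.size_pos.2 q.den_pos)

theorem bitLength_pos (q : ℚ) : 1 ≤ bitLength q := by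
  unfold bitLength
  omega

theorem bitLength_le_height (q : ℚ) : bitLength q ≤ 1 + 2 * height q := by
  have h₁ : q.num.natAbs.size ≤ height q := le_max_left _ _
  have h₂ : q.den.size ≤ height q := le_max_right _ _
  unfold bitLength
  omega

theorem height_le_bitLength (q : ℚ) : height q ≤ bitLength q := by
  unfold bitLength height
  omega

theorem height_zero : height 0 = 1 := by simp [height]

theorem height_one : height 1 = 1 := by simp [height]

theorem height_neg (q : ℚ) : height (-q) = height q := by simp [height]

theorem height_inv_le (q : ℚ) : height q⁻¹ ≤ height q := by
  rcases eq_or_ne q 0 with rfl | hq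
  · simp
  have hn : q.num ≠ 0 := Rat.num_ne_zero.2 hq
  have hd : q⁻¹.den = q.num.natAbs := by simp [Rat.den_inv, hn]
  have hm : q⁻¹.num.natAbs = q.den := by
    rw [Rat.num_inv, Int.natAbs_mul, Int.natAbs_sign_of_ne_zero hn]
    simp
  unfold height
  rw [hd, hm, max_comm]

theorem height_mul_le (a b : ℚ) : height (a * b) ≤ height a + height b := by
  obtain ⟨ha, ha'⟩ := height_le_iff.1 (le_refl (height a))
  obtain ⟨hb, hb'⟩ := height_le_iff.1 (le_refl (height b))
  rw [height_le_iff, pow_add]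
  constructor
  · rw [Rat.mul_num, Int.natAbs_ediv_of_dvd (Int.ofNat_dvd_left.2 (Nat.gcd_dvd_left _ _)),
      Int.natAbs_mul]
    exact (Nat.div_le_self _ _).trans_lt (Nat.mul_lt_mul'' ha hb)
  · exact (Nat.le_of_dvd (Nat.mul_pos a.den_pos b.den_pos) (Rat.mul_den_dvd a b)).trans_lt
      (Nat.mul_lt_mul'' ha' hb')

theorem height_add_le (a b : ℚ) : height (a + b) ≤ height a + height b + 1 := by
  obtain ⟨ha, ha'⟩ := height_le_iff.1 (le_refl (height a))
  obtain ⟨hb, hb'⟩ := height_le_iff.1 (le_refl (height b))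
  rw [height_le_iff, pow_succ, pow_add]
  constructor
  · rcases eq_or_ne (a.num * b.den + a.den * b.num) 0 with h | h
    · rw [Rat.add_num_den, h]
      simp
    · have hdvd : (a + b).num ∣ a.num * b.den + a.den * b.num := by
        rw [Rat.add_num_den]
        exact Rat.num_dvd _ (by simp)
      have h₁ := Int.natAbs_le_of_dvd_ne_zero hdvd h
      have h₂ := Int.natAbs_add_le (a.num * b.den) (a.den * b.num)
      simp only [Int.natAbs_mul, Int.natAbs_natCast] at h₂
      have h₃ := Nat.mul_lt_mul'' ha hb'
      have h₄ := Nat.mul_lt_mul'' ha' hb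
      omega
  · have h₁ := Nat.le_of_dvd (Nat.mul_pos a.den_pos b.den_pos) (Rat.add_den_dvd a b)
    have h₂ := Nat.mul_lt_mul'' ha' hb'
    omega

theorem height_sub_le (a b : ℚ) : height (a - b) ≤ height a + height b + 1 := by
  rw [sub_eq_add_neg, ← height_neg b]
  exact height_add_le _ _

theorem height_div_le (a b : ℚ) : height (a / b) ≤ height a + height b := by
  rw [div_eq_mul_inv]
  exact (height_mul_le _ _).trans (by have := height_inv_le b; omega)

/-! ### Heights and costs of expressions -/

namespace Expr

/-- Every operand of the expression is a constant or a cell of an array of level less than `l`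
(index computations do not count). -/
def lowLevel (lvl : ℕ → ℕ) (l : ℕ) : Expr → Bool
  | const _ => true
  | get a _ => decide (lvl a < l)
  | add e₁ e₂ => e₁.lowLevel lvl l && e₂.lowLevel lvl l
  | sub e₁ e₂ => e₁.lowLevel lvl l && e₂.lowLevel lvl l
  | mul e₁ e₂ => e₁.lowLevel lvl l && e₂.lowLevel lvl l
  | div e₁ e₂ => e₁.lowLevel lvl l && e₂.lowLevel lvl l

/-- At most one operand of the expression is a cell of an array of level `l`; all others are
constants or cells of arrays of smaller level. -/
def linear (lvl : ℕ → ℕ) (l : ℕ) : Expr → Bool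
  | const _ => true
  | get a _ => decide (lvl a ≤ l)
  | add e₁ e₂ => (e₁.linear lvl l && e₂.lowLevel lvl l) || (e₁.lowLevel lvl l && e₂.linear lvl l)
  | sub e₁ e₂ => (e₁.linear lvl l && e₂.lowLevel lvl l) || (e₁.lowLevel lvl l && e₂.linear lvl l)
  | mul e₁ e₂ => (e₁.linear lvl l && e₂.lowLevel lvl l) || (e₁.lowLevel lvl l && e₂.linear lvl l)
  | div e₁ e₂ => (e₁.linear lvl l && e₂.lowLevel lvl l) || (e₁.lowLevel lvl l && e₂.linear lvl l)

/-- The expression reads no array other than array `0`, not even in an index. -/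
def inputOnly : Expr → Bool
  | const _ => true
  | get a e => decide (a = 0) && e.inputOnly
  | add e₁ e₂ => e₁.inputOnly && e₂.inputOnly
  | sub e₁ e₂ => e₁.inputOnly && e₂.inputOnly
  | mul e₁ e₂ => e₁.inputOnly && e₂.inputOnly
  | div e₁ e₂ => e₁.inputOnly && e₂.inputOnly

/-- The syntactic weight that governs the growth of heights under evaluation. -/
def weight : Expr → ℕ
  | const q => height q
  | get _ _ => 1
  | add e₁ e₂ => e₁.weight + e₂.weight + 1
  | sub e₁ e₂ => e₁.weight + e₂.weight + 1
  | mul e₁ e₂ => e₁.weight + e₂.weight + 1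
  | div e₁ e₂ => e₁.weight + e₂.weight + 1

theorem height_eval_le_of_lowLevel {lvl : ℕ → ℕ} {l B : ℕ} {σ : Memory}
    (hσ : ∀ a i, lvl a < l → height (σ a i) ≤ B) (e : Expr) (he : e.lowLevel lvl l) :
    height (e.eval σ) ≤ e.weight * (B + 1) := by
  induction e with
  | const q => exact Nat.le_mul_of_pos_right _ (Nat.succ_pos _)
  | get a e _ =>
    have := hσ a ⌊e.eval σ⌋₊ (by simpa [lowLevel] using he)
    simp only [eval, weight]
    omega
  | add e₁ e₂ h₁ h₂ | sub e₁ e₂ h₁ h₂ | mul e₁ e₂ h₁ h₂ | div e₁ e₂ h₁ h₂ =>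
    simp only [lowLevel, Bool.and_eq_true] at he
    have h := add_le_add (h₁ he.1) (h₂ he.2)
    simp only [eval, weight, add_mul]
    have := height_add_le (e₁.eval σ) (e₂.eval σ)
    have := height_sub_le (e₁.eval σ) (e₂.eval σ)
    have := height_mul_le (e₁.eval σ) (e₂.eval σ)
    have := height_div_le (e₁.eval σ) (e₂.eval σ)
    omega

theorem height_eval_le_of_linear {lvl : ℕ → ℕ} {l A B : ℕ} {σ : Memory}
    (hσ : ∀ a i, lvl a < l → height (σ a i) ≤ B) (hσ' : ∀ a i, lvl a ≤ l → height (σ a i) ≤ A)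
    (e : Expr) (he : e.linear lvl l) :
    height (e.eval σ) ≤ A + e.weight * (B + 1) := by
  induction e with
  | const q =>
    exact (Nat.le_mul_of_pos_right _ (Nat.succ_pos _)).trans (Nat.le_add_left _ _)
  | get a e _ =>
    have := hσ' a ⌊e.eval σ⌋₊ (by simpa [linear] using he)
    simp only [eval]
    omega
  | add e₁ e₂ h₁ h₂ | sub e₁ e₂ h₁ h₂ | mul e₁ e₂ h₁ h₂ | div e₁ e₂ h₁ h₂ =>
    simp only [linear, Bool.and_eq_true, Bool.or_eq_true] at he
    have h : height (e₁.eval σ) + height (e₂.eval σ) ≤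
        A + (e₁.weight * (B + 1) + e₂.weight * (B + 1)) := by
      rcases he with he | he
      · have := h₁ he.1
        have := height_eval_le_of_lowLevel hσ e₂ he.2
        omega
      · have := height_eval_le_of_lowLevel hσ e₁ he.1
        have := h₂ he.2
        omega
    simp only [eval, weight, add_mul]
    have := height_add_le (e₁.eval σ) (e₂.eval σ)
    have := height_sub_le (e₁.eval σ) (e₂.eval σ)
    have := height_mul_le (e₁.eval σ) (e₂.eval σ)
    have := height_div_le (e₁.eval σ) (e₂.eval σ)
    omega

theorem height_eval_le {H : ℕ} {σ : Memory} (hσ : ∀ a i, height (σ a i) ≤ H) (e : Expr) :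
    height (e.eval σ) ≤ e.weight * (H + 1) := by
  -- with a single level below `1`, every expression qualifies
  refine height_eval_le_of_lowLevel (lvl := fun _ => 0) (l := 1) (fun a i _ => hσ a i) e ?_
  induction e <;> simp_all [lowLevel]

/-- The cost of evaluating an expression is linear in the height of the memory. -/
theorem exists_cost_le (e : Expr) : ∃ K : ℕ, ∀ (σ : Memory) (H : ℕ),
    (∀ a i, height (σ a i) ≤ H) → e.cost σ ≤ K * (H + 1) := by
  have key : ∀ (e : Expr) (σ : Memory) (H : ℕ), (∀ a i, height (σ a i) ≤ H) →
      bitLength (e.eval σ) ≤ (1 + 2 * e.weight) * (H + 1) := by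
    intro e σ H hσ
    have h₁ := bitLength_le_height (e.eval σ)
    have h₂ := height_eval_le hσ e
    rw [add_mul, mul_assoc]
    omega
  induction e with
  | const q => exact ⟨_, fun σ H hσ => key (const q) σ H hσ⟩
  | get a e ih =>
    obtain ⟨K, hK⟩ := ih
    refine ⟨1 + 2 * (get a e).weight + K, fun σ H hσ => ?_⟩
    rw [add_mul _ K]
    exact add_le_add (key _ σ H hσ) (hK σ H hσ)
  | add e₁ e₂ h₁ h₂ | sub e₁ e₂ h₁ h₂ | mul e₁ e₂ h₁ h₂ | div e₁ e₂ h₁ h₂ =>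
    obtain ⟨K₁, hK₁⟩ := h₁
    obtain ⟨K₂, hK₂⟩ := h₂
    refine ⟨1 + 2 * (e₁.weight + e₂.weight + 1) + K₁ + K₂, fun σ H hσ => ?_⟩
    rw [add_mul _ K₂, add_mul _ K₁]
    exact add_le_add (add_le_add (key _ σ H hσ) (hK₁ σ H hσ)) (hK₂ σ H hσ)

theorem eval_congr_of_inputOnly {σ τ : Memory} (h : σ 0 = τ 0) (e : Expr) (he : e.inputOnly) :
    e.eval σ = e.eval τ := by
  induction e with
  | const q => rfl
  | get a e ih =>
    simp only [inputOnly, Bool.and_eq_true, decide_eq_true_eq] at he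
    simp only [eval]
    rw [ih he.2, he.1, h]
  | add e₁ e₂ h₁ h₂ | sub e₁ e₂ h₁ h₂ | mul e₁ e₂ h₁ h₂ | div e₁ e₂ h₁ h₂ =>
    simp only [inputOnly, Bool.and_eq_true] at he
    simp only [eval]
    rw [h₁ he.1, h₂ he.2]

end Expr

/-! ### Polynomially bounded functions -/

/-- A function `ℕ → ℕ` that is bounded by a polynomial. -/
def PolyBounded (f : ℕ → ℕ) : Prop := ∃ C k : ℕ, ∀ x, f x ≤ C * (x + 1) ^ k

namespace PolyBounded

theorem const (c : ℕ) : PolyBounded fun _ => c := ⟨c, 0, fun x => by simp⟩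

theorem id : PolyBounded fun x => x := ⟨1, 1, fun x => by simp⟩

theorem add {f g : ℕ → ℕ} (hf : PolyBounded f) (hg : PolyBounded g) :
    PolyBounded fun x => f x + g x := by
  obtain ⟨C, k, h⟩ := hf
  obtain ⟨D, l, h'⟩ := hg
  refine ⟨C + D, k + l, fun x => ?_⟩
  have h₁ : (x + 1) ^ k ≤ (x + 1) ^ (k + l) := Nat.pow_le_pow_right (Nat.succ_pos x) (by omega)
  have h₂ : (x + 1) ^ l ≤ (x + 1) ^ (k + l) := Nat.pow_le_pow_right (Nat.succ_pos x) (by omega)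
  rw [add_mul]
  exact add_le_add ((h x).trans (Nat.mul_le_mul_left _ h₁))
    ((h' x).trans (Nat.mul_le_mul_left _ h₂))

theorem mul {f g : ℕ → ℕ} (hf : PolyBounded f) (hg : PolyBounded g) :
    PolyBounded fun x => f x * g x := by
  obtain ⟨C, k, h⟩ := hf
  obtain ⟨D, l, h'⟩ := hg
  refine ⟨C * D, k + l, fun x => ?_⟩
  rw [pow_add, mul_mul_mul_comm]
  exact Nat.mul_le_mul (h x) (h' x)

theorem comp {f g : ℕ → ℕ} (hf : PolyBounded f) (hg : PolyBounded g) :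
    PolyBounded fun x => f (g x) := by
  obtain ⟨C, k, h⟩ := hf
  obtain ⟨D, l, h'⟩ := hg
  refine ⟨C * (D + 1) ^ k, l * k, fun x => (h (g x)).trans ?_⟩
  have : g x + 1 ≤ (D + 1) * (x + 1) ^ l := by
    have := h' x
    have : 1 ≤ (x + 1) ^ l := Nat.one_le_pow _ _ (Nat.succ_pos x)
    rw [add_mul]
    omega
  rw [mul_assoc, pow_mul, ← mul_pow]
  exact Nat.mul_le_mul_left _ (Nat.pow_le_pow_left this k)

end PolyBounded

/-! ### The running time of levelled programs -/

/-- A bound for the heights in the arrays of level `l` after `t` assignments, if all heights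
are at most `h` at the beginning and all expressions have weight at most `K`. -/
def heightBound (K h : ℕ) : ℕ → ℕ → ℕ
  | 0, _ => h
  | l + 1, t => h + t * (K * (heightBound K h l t + 1))

theorem heightBound_mono_time (K h l : ℕ) : Monotone (heightBound K h l) := by
  induction l with
  | zero => exact fun _ _ _ => le_rfl
  | succ l ih =>
    intro s t hst
    simp only [heightBound]
    gcongr
    exact ih hst

theorem heightBound_le_succ {K : ℕ} (hK : 1 ≤ K) (h l t : ℕ) :
    heightBound K h l t ≤ heightBound K h (l + 1) t := by
  rcases Nat.eq_zero_or_pos t with rfl | ht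
  · cases l <;> simp [heightBound]
  · simp only [heightBound]
    have h₁ := Nat.mul_le_mul ht (Nat.mul_le_mul_right (heightBound K h l t + 1) hK)
    omega

theorem heightBound_mono_level {K : ℕ} (hK : 1 ≤ K) (h t : ℕ) :
    Monotone fun l => heightBound K h l t :=
  monotone_nat_of_le_succ fun l => heightBound_le_succ hK h l t

theorem polyBounded_heightBound (K l : ℕ) {f : ℕ → ℕ} (hf : PolyBounded f) :
    PolyBounded fun x => heightBound K x l (f x) := by
  induction l with
  | zero => exact .id
  | succ l ih => exact .add .id (.mul hf (.mul (.const K) (.add ih (.const 1))))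

namespace Program

/-- The program respects the levels `lvl` of the arrays: arrays of level `0` and array `0` are
never written, an expression stored in an array of level `l` reads at most one cell of level `l`
besides cells of smaller level, and the numbers of rounds of loops depend on array `0` only. -/
def levelled (lvl : ℕ → ℕ) : Program → Bool
  | set a _ e => decide (a ≠ 0) && decide (0 < lvl a) && e.linear lvl (lvl a)
  | flip a _ => decide (a ≠ 0) && decide (0 < lvl a)
  | seq c₁ c₂ => c₁.levelled lvl && c₂.levelled lvl
  | ite _ _ c₁ c₂ => c₁.levelled lvl && c₂.levelled lvl
  | loop e c => e.inputOnly && c.levelled lvl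

/-- All loops make at most `R` rounds when started on a memory with the same array `0`
as `σ`. -/
def loopsLe (σ : Memory) (R : ℕ) : Program → Prop
  | set _ _ _ => True
  | flip _ _ => True
  | seq c₁ c₂ => c₁.loopsLe σ R ∧ c₂.loopsLe σ R
  | ite _ _ c₁ c₂ => c₁.loopsLe σ R ∧ c₂.loopsLe σ R
  | loop e c => ⌊e.eval σ⌋₊ ≤ R ∧ c.loopsLe σ R

/-- A bound for the number of assignments if every loop makes at most `R` rounds. -/
def steps (R : ℕ) : Program → ℕ
  | set _ _ _ => 1
  | flip _ _ => 1
  | seq c₁ c₂ => c₁.steps R + c₂.steps R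
  | ite _ _ c₁ c₂ => c₁.steps R + c₂.steps R
  | loop _ c => R * c.steps R

/-- A bound for the running time if every loop makes at most `R` rounds and every expression
costs at most `U`. -/
def timeBound (R U : ℕ) : Program → ℕ
  | set _ _ _ => 1 + U + U
  | flip _ _ => 1 + U
  | seq c₁ c₂ => c₁.timeBound R U + c₂.timeBound R U
  | ite _ _ c₁ c₂ => 1 + U + U + (c₁.timeBound R U + c₂.timeBound R U)
  | loop _ c => 1 + U + R * (c.timeBound R U + 1)

/-- The weights of all stored expressions are at most `K`, and `K` bounds the costs of all
expressions per unit of height. -/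
def bounded (K : ℕ) : Program → Prop
  | set _ i e => e.weight ≤ K ∧
      (∀ (σ : Memory) (H : ℕ), (∀ a i, height (σ a i) ≤ H) → i.cost σ ≤ K * (H + 1)) ∧
      (∀ (σ : Memory) (H : ℕ), (∀ a i, height (σ a i) ≤ H) → e.cost σ ≤ K * (H + 1))
  | flip _ i =>
      (∀ (σ : Memory) (H : ℕ), (∀ a i, height (σ a i) ≤ H) → i.cost σ ≤ K * (H + 1))
  | seq c₁ c₂ => c₁.bounded K ∧ c₂.bounded K
  | ite e₁ e₂ c₁ c₂ =>
      (∀ (σ : Memory) (H : ℕ), (∀ a i, height (σ a i) ≤ H) → e₁.cost σ ≤ K * (H + 1)) ∧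
      (∀ (σ : Memory) (H : ℕ), (∀ a i, height (σ a i) ≤ H) → e₂.cost σ ≤ K * (H + 1)) ∧
      c₁.bounded K ∧ c₂.bounded K
  | loop e c =>
      (∀ (σ : Memory) (H : ℕ), (∀ a i, height (σ a i) ≤ H) → e.cost σ ≤ K * (H + 1)) ∧
      c.bounded K

theorem bounded.mono {K K' : ℕ} (hK : K ≤ K') {c : Program} (h : c.bounded K) :
    c.bounded K' := by
  have aux : ∀ {x H : ℕ}, x ≤ K * (H + 1) → x ≤ K' * (H + 1) := fun h =>
    h.trans (Nat.mul_le_mul_right _ hK)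
  induction c with
  | set a i e =>
    exact ⟨h.1.trans hK, fun σ H hσ => aux (h.2.1 σ H hσ), fun σ H hσ => aux (h.2.2 σ H hσ)⟩
  | flip a i => exact fun σ H hσ => aux (h σ H hσ)
  | seq c₁ c₂ h₁ h₂ => exact ⟨h₁ h.1, h₂ h.2⟩
  | ite e₁ e₂ c₁ c₂ h₁ h₂ =>
    exact ⟨fun σ H hσ => aux (h.1 σ H hσ), fun σ H hσ => aux (h.2.1 σ H hσ),
      h₁ h.2.2.1, h₂ h.2.2.2⟩
  | loop e c ih => exact ⟨fun σ H hσ => aux (h.1 σ H hσ), ih h.2⟩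

theorem exists_bounded (c : Program) : ∃ K, c.bounded K := by
  have aux : ∀ {x K K' H : ℕ}, K ≤ K' → x ≤ K * (H + 1) → x ≤ K' * (H + 1) := fun hK h =>
    h.trans (Nat.mul_le_mul_right _ hK)
  induction c with
  | set a i e =>
    obtain ⟨K₁, h₁⟩ := i.exists_cost_le
    obtain ⟨K₂, h₂⟩ := e.exists_cost_le
    exact ⟨e.weight + K₁ + K₂, by omega, fun σ H hσ => aux (by omega) (h₁ σ H hσ),
      fun σ H hσ => aux (by omega) (h₂ σ H hσ)⟩
  | flip a i => exact i.exists_cost_le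
  | seq c₁ c₂ h₁ h₂ =>
    obtain ⟨K₁, h₁⟩ := h₁
    obtain ⟨K₂, h₂⟩ := h₂
    exact ⟨K₁ + K₂, h₁.mono (by omega), h₂.mono (by omega)⟩
  | ite e₁ e₂ c₁ c₂ h₁ h₂ =>
    obtain ⟨K₁, h₁⟩ := h₁
    obtain ⟨K₂, h₂⟩ := h₂
    obtain ⟨K₃, h₃⟩ := e₁.exists_cost_le
    obtain ⟨K₄, h₄⟩ := e₂.exists_cost_le
    exact ⟨K₁ + K₂ + K₃ + K₄, fun σ H hσ => aux (by omega) (h₃ σ H hσ),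
      fun σ H hσ => aux (by omega) (h₄ σ H hσ), h₁.mono (by omega), h₂.mono (by omega)⟩
  | loop e c ih =>
    obtain ⟨K₁, h₁⟩ := ih
    obtain ⟨K₂, h₂⟩ := e.exists_cost_le
    exact ⟨K₁ + K₂, fun σ H hσ => aux (by omega) (h₂ σ H hσ), h₁.mono (by omega)⟩

theorem polyBounded_steps (c : Program) {f : ℕ → ℕ} (hf : PolyBounded f) :
    PolyBounded fun x => c.steps (f x) := by
  induction c with
  | set a i e => exact .const 1
  | flip a i => exact .const 1
  | seq c₁ c₂ h₁ h₂ => exact .add h₁ h₂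
  | ite e₁ e₂ c₁ c₂ h₁ h₂ => exact .add h₁ h₂
  | loop e c ih => exact .mul hf ih

theorem polyBounded_timeBound (c : Program) {f g : ℕ → ℕ} (hf : PolyBounded f)
    (hg : PolyBounded g) : PolyBounded fun x => c.timeBound (f x) (g x) := by
  induction c with
  | set a i e => exact .add (.add (.const 1) hg) hg
  | flip a i => exact .add (.const 1) hg
  | seq c₁ c₂ h₁ h₂ => exact .add h₁ h₂
  | ite e₁ e₂ c₁ c₂ h₁ h₂ => exact .add (.add (.add (.const 1) hg) hg) (.add h₁ h₂)
  | loop e c ih => exact .add (.add (.const 1) hg) (.mul hf (.add ih (.const 1)))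

section
variable {lvl : ℕ → ℕ} {K h Λ S R : ℕ}

/-- The invariant behind the time bound: after `t` assignments the heights in the arrays of level
`l` are at most `heightBound K h l t`. -/
def heightsLe (lvl : ℕ → ℕ) (K h t : ℕ) (σ : Memory) : Prop :=
  ∀ a i, height (σ a i) ≤ heightBound K h (lvl a) t

theorem heightsLe.mono {s t : ℕ} (hst : s ≤ t) {σ : Memory} (hσ : heightsLe lvl K h s σ) :
    heightsLe lvl K h t σ :=
  fun a i => (hσ a i).trans (heightBound_mono_time _ _ _ hst)

theorem heightsLe.write {t : ℕ} {σ : Memory} (hσ : heightsLe lvl K h t σ) {a i : ℕ} {q : ℚ}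
    (hq : height q ≤ heightBound K h (lvl a) (t + 1)) :
    heightsLe lvl K h (t + 1) (σ.write a i q) := by
  intro b j
  unfold Memory.write
  by_cases hb : b = a
  · subst hb
    by_cases hj : j = i
    · subst hj
      simpa using hq
    · simpa [hj] using hσ.mono (Nat.le_succ t) b j
  · simpa [hb] using hσ.mono (Nat.le_succ t) b j

theorem heightsLe.eval {t : ℕ} {σ : Memory} (hK : 1 ≤ K) (hσ : heightsLe lvl K h t σ) {e : Expr}
    {l : ℕ} (hl : 0 < l) (he : e.linear lvl l) (hw : e.weight ≤ K) :
    height (e.eval σ) ≤ heightBound K h l (t + 1) := by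
  obtain ⟨l, rfl⟩ := Nat.exists_eq_succ_of_ne_zero hl.ne'
  have h₁ := e.height_eval_le_of_linear (lvl := lvl) (l := l + 1) (B := heightBound K h l t)
    (A := heightBound K h (l + 1) t) (σ := σ)
    (fun a i ha => (hσ a i).trans (heightBound_mono_level hK h t (Nat.lt_succ_iff.1 ha)))
    (fun a i ha => (hσ a i).trans (heightBound_mono_level hK h t ha)) he
  refine h₁.trans ?_
  have h₂ : heightBound K h l t ≤ heightBound K h l (t + 1) :=
    heightBound_mono_time _ _ _ (Nat.le_succ t)
  simp only [heightBound]
  calc h + t * (K * (heightBound K h l t + 1)) + e.weight * (heightBound K h l t + 1)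
      ≤ h + t * (K * (heightBound K h l (t + 1) + 1))
        + K * (heightBound K h l (t + 1) + 1) := by gcongr
    _ = h + (t + 1) * (K * (heightBound K h l (t + 1) + 1)) := by ring

/-- Along every run of a levelled program the heights obey the invariant, and the time bound
holds. -/
theorem run_bound (hK : 1 ≤ K) (hh : 1 ≤ h) (hΛ : ∀ a, lvl a ≤ Λ) {σ₀ : Memory} (c : Program)
    (hlev : c.levelled lvl) (hloop : c.loopsLe σ₀ R) (hb : c.bounded K) :
    ∀ (t : ℕ) (σ : Memory), t + c.steps R ≤ S → σ 0 = σ₀ 0 → heightsLe lvl K h t σ →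
      ∀ z ∈ (c.run σ).support, z.1 0 = σ₀ 0 ∧ heightsLe lvl K h (t + c.steps R) z.1 ∧
        z.2 ≤ c.timeBound R (K * (heightBound K h Λ S + 1)) := by
  have hcost : ∀ {t σ}, t ≤ S → heightsLe lvl K h t σ →
      ∀ a i, height (σ a i) ≤ heightBound K h Λ S := fun ht hσ a i =>
    (hσ a i).trans ((heightBound_mono_level hK h _ (hΛ a)).trans (heightBound_mono_time _ _ _ ht))
  induction c with
  | set a i e =>
    simp only [levelled, Bool.and_eq_true, decide_eq_true_eq] at hlev
    intro t σ ht h0 hσ z hz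
    simp only [steps] at ht
    simp only [run, PMF.support_pure, Set.mem_singleton_iff] at hz
    subst hz
    refine ⟨?_, hσ.write (hσ.eval hK hlev.1.2 hlev.2 hb.1), ?_⟩
    · simp [Memory.write, Function.update_of_ne hlev.1.1.symm, h0]
    · have h₁ := hb.2.1 σ _ (hcost (by omega) hσ)
      have h₂ := hb.2.2 σ _ (hcost (by omega) hσ)
      simp only [timeBound]
      omega
  | flip a i =>
    simp only [levelled, Bool.and_eq_true, decide_eq_true_eq] at hlev
    intro t σ ht h0 hσ z hz
    simp only [steps] at ht
    simp only [run, PMF.mem_support_map_iff] at hz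
    obtain ⟨b, -, rfl⟩ := hz
    refine ⟨?_, hσ.write ?_, ?_⟩
    · simp [Memory.write, Function.update_of_ne hlev.1.symm, h0]
    · have : height (if b then 1 else 0) = 1 := by cases b <;> simp [height_zero, height_one]
      rw [this]
      exact hh.trans (heightBound_mono_level hK h _ (Nat.zero_le _))
    · have h₁ := hb σ _ (hcost (by omega) hσ)
      simp only [timeBound]
      omega
  | seq c₁ c₂ h₁ h₂ =>
    simp only [levelled, Bool.and_eq_true] at hlev
    intro t σ ht h0 hσ z hz
    simp only [steps] at ht
    simp only [run, PMF.mem_support_bind_iff, PMF.mem_support_map_iff] at hz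
    obtain ⟨x, hx, y, hy, rfl⟩ := hz
    obtain ⟨hx0, hxh, hxt⟩ := h₁ hlev.1 hloop.1 hb.1 t σ (by omega) h0 hσ x hx
    obtain ⟨hy0, hyh, hyt⟩ := h₂ hlev.2 hloop.2 hb.2 _ x.1 (by omega) hx0 hxh y hy
    refine ⟨hy0, ?_, ?_⟩
    · simpa only [steps, add_assoc] using hyh
    · simp only [timeBound]
      omega
  | ite e₁ e₂ c₁ c₂ h₁ h₂ =>
    simp only [levelled, Bool.and_eq_true] at hlev
    intro t σ ht h0 hσ z hz
    simp only [steps] at ht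
    simp only [run, PMF.mem_support_map_iff] at hz
    obtain ⟨x, hx, rfl⟩ := hz
    have k₁ := hb.1 σ _ (hcost (by omega) hσ)
    have k₂ := hb.2.1 σ _ (hcost (by omega) hσ)
    split_ifs at hx
    · obtain ⟨hx0, hxh, hxt⟩ := h₁ hlev.1 hloop.1 hb.2.2.1 t σ (by omega) h0 hσ x hx
      refine ⟨hx0, hxh.mono (by simp only [steps]; omega), ?_⟩
      simp only [timeBound]
      omega
    · obtain ⟨hx0, hxh, hxt⟩ := h₂ hlev.2 hloop.2 hb.2.2.2 t σ (by omega) h0 hσ x hx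
      refine ⟨hx0, hxh.mono (by simp only [steps]; omega), ?_⟩
      simp only [timeBound]
      omega
  | loop e c ih =>
    simp only [levelled, Bool.and_eq_true] at hlev
    intro t σ ht h0 hσ z hz
    simp only [steps] at ht
    simp only [run, PMF.mem_support_map_iff] at hz
    obtain ⟨x, hx, rfl⟩ := hz
    have k₁ := hb.1 σ _ (hcost (by omega) hσ)
    set U := K * (heightBound K h Λ S + 1)
    have hR : ⌊e.eval σ⌋₊ ≤ R := by
      rw [e.eval_congr_of_inputOnly h0 hlev.1]
      exact hloop.1
    have key : ∀ (k t : ℕ) (σ : Memory), t + k * c.steps R ≤ S → σ 0 = σ₀ 0 →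
        heightsLe lvl K h t σ → ∀ z ∈ (iterate c.run k σ).support, z.1 0 = σ₀ 0 ∧
          heightsLe lvl K h (t + k * c.steps R) z.1 ∧ z.2 ≤ k * (c.timeBound R U + 1) := by
      intro k
      induction k with
      | zero =>
        intro t σ _ h0 hσ z hz
        simp only [iterate, PMF.support_pure, Set.mem_singleton_iff] at hz
        subst hz
        simpa using ⟨h0, hσ⟩
      | succ k ihk =>
        intro t σ ht h0 hσ z hz
        rw [Nat.succ_mul] at ht
        simp only [iterate, PMF.mem_support_bind_iff, PMF.mem_support_map_iff] at hz
        obtain ⟨x, hx, y, hy, rfl⟩ := hz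
        obtain ⟨hx0, hxh, hxt⟩ := ih hlev.2 hloop.2 hb.2 t σ (by omega) h0 hσ x hx
        obtain ⟨hy0, hyh, hyt⟩ := ihk _ x.1 (by omega) hx0 hxh y hy
        refine ⟨hy0, hyh.mono ?_, ?_⟩
        · rw [Nat.succ_mul]
          omega
        · rw [Nat.succ_mul]
          simp only
          omega
    have hle : ⌊e.eval σ⌋₊ * c.steps R ≤ R * c.steps R := Nat.mul_le_mul_right _ hR
    obtain ⟨hx0, hxh, hxt⟩ := key _ t σ (by omega) h0 hσ x hx
    refine ⟨hx0, hxh.mono (by simp only [steps]; omega), ?_⟩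
    have := Nat.mul_le_mul_right (c.timeBound R U + 1) hR
    simp only [timeBound]
    omega

end

/-- The running time of a levelled program is bounded by a polynomial in the height of the
initial memory and the number of rounds of its loops. -/
theorem exists_polyBounded_time {lvl : ℕ → ℕ} {Λ : ℕ} (hΛ : ∀ a, lvl a ≤ Λ) (c : Program)
    (hlev : c.levelled lvl) : ∃ f : ℕ → ℕ, PolyBounded f ∧ ∀ (X : ℕ) (σ : Memory), c.loopsLe σ X →
      (∀ a i, height (σ a i) ≤ X) → ∀ z ∈ (c.run σ).support, z.2 ≤ f X := by
  obtain ⟨K, hK⟩ := c.exists_bounded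
  have hK' : c.bounded (K + 1) := hK.mono (Nat.le_succ K)
  refine ⟨fun X => c.timeBound X ((K + 1) * (heightBound (K + 1) X Λ (c.steps X) + 1)),
    c.polyBounded_timeBound .id (.mul (.const _) (.add (polyBounded_heightBound _ _
      (c.polyBounded_steps .id)) (.const 1))), fun X σ hloop hσ z hz => ?_⟩
  refine (c.run_bound (S := c.steps X) (h := X) (Nat.succ_pos K) ((height_pos _).trans (hσ 0 0)) hΛ
    hlev hloop hK' 0 σ (by omega) rfl (fun a i => (hσ a i).trans ?_) z hz).2.2
  exact heightBound_mono_level (Nat.succ_pos K) X 0 (Nat.zero_le _)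

end Program

/-! ### Uniform distributions -/

section
variable {α β Ω : Type} [Fintype α] [Nonempty α] [Fintype β] [Nonempty β] [Fintype Ω] [Nonempty Ω]

theorem map_uniformOfFintype_equiv (e : α ≃ β) :
    (PMF.uniformOfFintype α).map e = PMF.uniformOfFintype β := by
  ext b
  rw [PMF.map_apply, tsum_eq_single (e.symm b)]
  · simp [Fintype.card_congr e]
  · intro a ha
    rw [if_neg]
    rintro rfl
    simp at ha

theorem uniformOfFintype_bind_map {γ : Type} (g : α → Ω → γ) :
    ((PMF.uniformOfFintype α).bind fun a => (PMF.uniformOfFintype Ω).map (g a)) =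
      (PMF.uniformOfFintype (α × Ω)).map fun x => g x.1 x.2 := by
  have h : PMF.uniformOfFintype (α × Ω) =
      (PMF.uniformOfFintype α).bind fun a => (PMF.uniformOfFintype Ω).map (Prod.mk a) := by
    ext ⟨a, o⟩
    rw [PMF.bind_apply, tsum_eq_single a, PMF.map_apply, tsum_eq_single o]
    · simp only [PMF.uniformOfFintype_apply, Fintype.card_prod, if_true, Nat.cast_mul]
      exact ENNReal.mul_inv (Or.inr (ENNReal.natCast_ne_top _)) (Or.inl (ENNReal.natCast_ne_top _))
    · intro o' ho
      rw [if_neg]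
      simpa using ho.symm
    · intro a' ha
      simp [PMF.map_apply, ha.symm]
  rw [h, PMF.map_bind]
  congr 1
  ext1 a
  rw [PMF.map_comp]
  rfl

end

/-! ### Laws of the final memory and program logic -/

/-- The law of the memory after `k` rounds of a random transformation of the memory. -/
noncomputable def iterateLaw (f : Memory → PMF Memory) : ℕ → Memory → PMF Memory
  | 0, σ => PMF.pure σ
  | k + 1, σ => (iterateLaw f k σ).bind f

theorem iterateLaw_succ' (f : Memory → PMF Memory) (k : ℕ) (σ : Memory) :
    iterateLaw f (k + 1) σ = (f σ).bind (iterateLaw f k) := by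
  induction k generalizing σ with
  | zero => simp [iterateLaw]
  | succ k ih =>
    rw [iterateLaw, ih, PMF.bind_bind]
    rfl

theorem map_fst_iterate (g : Memory → PMF (Memory × ℕ)) (k : ℕ) (σ : Memory) :
    (iterate g k σ).map Prod.fst = iterateLaw (fun τ => (g τ).map Prod.fst) k σ := by
  induction k generalizing σ with
  | zero => simp [iterate, iterateLaw, PMF.pure_map]
  | succ k ih =>
    rw [iterateLaw_succ', iterate, PMF.map_bind, PMF.bind_map]
    congr 1
    ext1 x
    rw [PMF.map_comp, Function.comp_apply, ← ih]
    rfl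

/-- The memories `σ` and `τ` agree outside the arrays in the list `l`. -/
def Memory.Agree (l : List ℕ) (σ τ : Memory) : Prop := ∀ a, a ∉ l → τ a = σ a

namespace Program

/-- The law of the final memory. -/
noncomputable def law (c : Program) (σ : Memory) : PMF Memory := (c.run σ).map Prod.fst

theorem law_set (a : ℕ) (i e : Expr) (σ : Memory) :
    (set a i e).law σ = PMF.pure (σ.write a ⌊i.eval σ⌋₊ (e.eval σ)) := by
  simp [law, run, PMF.pure_map]

theorem law_flip (a : ℕ) (i : Expr) (σ : Memory) :
    (flip a i).law σ = (PMF.uniformOfFintype Bool).map fun b =>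
      σ.write a ⌊i.eval σ⌋₊ (if b then 1 else 0) := by
  simp only [law, run, PMF.map_comp]
  rfl

theorem law_seq (c₁ c₂ : Program) (σ : Memory) :
    (seq c₁ c₂).law σ = (c₁.law σ).bind c₂.law := by
  simp only [law, run, PMF.map_bind, PMF.bind_map, PMF.map_comp]
  rfl

theorem law_ite (e₁ e₂ : Expr) (c₁ c₂ : Program) (σ : Memory) :
    (ite e₁ e₂ c₁ c₂).law σ = if e₁.eval σ ≤ e₂.eval σ then c₁.law σ else c₂.law σ := by
  simp only [law, run, PMF.map_comp]
  split_ifs <;> rfl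

theorem law_loop (e : Expr) (c : Program) (σ : Memory) :
    (loop e c).law σ = iterateLaw c.law ⌊e.eval σ⌋₊ σ := by
  simp only [law, run, PMF.map_comp]
  exact map_fst_iterate _ _ _

/-- The arrays that a program writes. -/
def targets : Program → List ℕ
  | set a _ _ => [a]
  | flip a _ => [a]
  | seq c₁ c₂ => c₁.targets ++ c₂.targets
  | ite _ _ c₁ c₂ => c₁.targets ++ c₂.targets
  | loop _ c => c.targets

theorem agree_of_mem_support (c : Program) :
    ∀ σ, ∀ τ ∈ (c.law σ).support, Memory.Agree c.targets σ τ := by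
  induction c with
  | set a i e =>
    intro σ τ hτ b hb
    simp only [law_set, PMF.support_pure, Set.mem_singleton_iff] at hτ
    subst hτ
    simp only [targets, List.mem_singleton] at hb
    simp [Memory.write, hb]
  | flip a i =>
    intro σ τ hτ b hb
    simp only [law_flip, PMF.mem_support_map_iff] at hτ
    obtain ⟨x, -, rfl⟩ := hτ
    simp only [targets, List.mem_singleton] at hb
    simp [Memory.write, hb]
  | seq c₁ c₂ h₁ h₂ =>
    intro σ τ hτ b hb
    simp only [law_seq, PMF.mem_support_bind_iff] at hτ
    obtain ⟨ρ, hρ, hτ⟩ := hτ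
    simp only [targets, List.mem_append, not_or] at hb
    rw [h₂ ρ τ hτ b hb.2, h₁ σ ρ hρ b hb.1]
  | ite e₁ e₂ c₁ c₂ h₁ h₂ =>
    intro σ τ hτ b hb
    simp only [targets, List.mem_append, not_or] at hb
    rw [law_ite] at hτ
    split_ifs at hτ
    · exact h₁ σ τ hτ b hb.1
    · exact h₂ σ τ hτ b hb.2
  | loop e c ih =>
    intro σ τ hτ b hb
    rw [law_loop] at hτ
    generalize ⌊e.eval σ⌋₊ = k at hτ
    induction k generalizing τ with
    | zero =>
      simp only [iterateLaw, PMF.support_pure, Set.mem_singleton_iff] at hτ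
      rw [hτ]
    | succ k ihk =>
      simp only [iterateLaw, PMF.mem_support_bind_iff] at hτ
      obtain ⟨ρ, hρ, hτ⟩ := hτ
      rw [ih ρ τ hτ b hb, ihk ρ hρ]

/-- Started on `σ`, the program ends in a memory that does not depend on the coin tosses and has
the property `Q`. -/
def Yields (c : Program) (σ : Memory) (Q : Memory → Prop) : Prop :=
  ∃ τ, c.law σ = PMF.pure τ ∧ Q τ

/-- Started on `σ`, the program ends in a memory that is determined by a uniformly distributed
element `ω` of `Ω` and is related to `ω` by `Q`. -/
def Samples (c : Program) (σ : Memory) (Ω : Type) [Fintype Ω] [Nonempty Ω]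
    (Q : Ω → Memory → Prop) : Prop :=
  ∃ F : Ω → Memory, c.law σ = (PMF.uniformOfFintype Ω).map F ∧ ∀ ω, Q ω (F ω)

theorem Yields.agree {c : Program} {σ : Memory} {Q : Memory → Prop} (h : c.Yields σ Q) :
    c.Yields σ fun τ => Q τ ∧ Memory.Agree c.targets σ τ := by
  obtain ⟨τ, hτ, hQ⟩ := h
  exact ⟨τ, hτ, hQ, c.agree_of_mem_support σ τ (by simp [hτ])⟩

theorem Yields.mono {c : Program} {σ : Memory} {P Q : Memory → Prop} (h : c.Yields σ P)
    (hPQ : ∀ τ, Memory.Agree c.targets σ τ → P τ → Q τ) : c.Yields σ Q := by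
  obtain ⟨τ, hτ, hP, ha⟩ := h.agree
  exact ⟨τ, hτ, hPQ τ ha hP⟩

theorem yields_set {a : ℕ} {i e : Expr} {σ : Memory} {Q : Memory → Prop}
    (h : Q (σ.write a ⌊i.eval σ⌋₊ (e.eval σ))) : (set a i e).Yields σ Q :=
  ⟨_, law_set _ _ _ _, h⟩

theorem yields_seq {c₁ c₂ : Program} {σ : Memory} {P Q : Memory → Prop} (h₁ : c₁.Yields σ P)
    (h₂ : ∀ τ, Memory.Agree c₁.targets σ τ → P τ → c₂.Yields τ Q) : (seq c₁ c₂).Yields σ Q := by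
  obtain ⟨τ, hτ, hP, ha⟩ := h₁.agree
  obtain ⟨ρ, hρ, hQ⟩ := h₂ τ ha hP
  exact ⟨ρ, by rw [law_seq, hτ, PMF.pure_bind, hρ], hQ⟩

theorem yields_set_seq {a : ℕ} {i e : Expr} {c : Program} {σ : Memory} {Q : Memory → Prop}
    (h : c.Yields (σ.write a ⌊i.eval σ⌋₊ (e.eval σ)) Q) : (seq (set a i e) c).Yields σ Q := by
  obtain ⟨ρ, hρ, hQ⟩ := h
  exact ⟨ρ, by rw [law_seq, law_set, PMF.pure_bind, hρ], hQ⟩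

theorem yields_ite {e₁ e₂ : Expr} {c₁ c₂ : Program} {σ : Memory} {Q : Memory → Prop}
    (h₁ : e₁.eval σ ≤ e₂.eval σ → c₁.Yields σ Q) (h₂ : e₂.eval σ < e₁.eval σ → c₂.Yields σ Q) :
    (ite e₁ e₂ c₁ c₂).Yields σ Q := by
  unfold Yields
  rw [law_ite]
  split_ifs with h
  · exact h₁ h
  · exact h₂ (not_le.1 h)

theorem yields_loop {e : Expr} {c : Program} {σ : Memory} (k : ℕ) (I : ℕ → Memory → Prop)
    (hk : ⌊e.eval σ⌋₊ = k) (h₀ : I 0 σ)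
    (h : ∀ j < k, ∀ τ, Memory.Agree c.targets σ τ → I j τ → c.Yields τ (I (j + 1))) :
    (loop e c).Yields σ (I k) := by
  unfold Yields
  rw [law_loop, hk]
  suffices H : ∀ j ≤ k, ∃ τ, iterateLaw c.law j σ = PMF.pure τ ∧ I j τ ∧
      Memory.Agree c.targets σ τ by
    obtain ⟨τ, h₁, h₂, -⟩ := H k le_rfl
    exact ⟨τ, h₁, h₂⟩
  intro j
  induction j with
  | zero => exact fun _ => ⟨σ, rfl, h₀, fun _ _ => rfl⟩
  | succ j ih =>
    intro hj
    obtain ⟨τ, hτ, hI, ha⟩ := ih (by omega)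
    obtain ⟨ρ, hρ, hI', ha'⟩ := (h j (by omega) τ ha hI).agree
    refine ⟨ρ, ?_, hI', fun a h => (ha' a h).trans (ha a h)⟩
    rw [iterateLaw, hτ, PMF.pure_bind, hρ]

section
variable {Ω : Type} [Fintype Ω] [Nonempty Ω]

theorem Samples.agree {c : Program} {σ : Memory} {Q : Ω → Memory → Prop}
    (h : c.Samples σ Ω Q) : c.Samples σ Ω fun ω τ => Q ω τ ∧ Memory.Agree c.targets σ τ := by
  obtain ⟨F, hF, hQ⟩ := h
  refine ⟨F, hF, fun ω => ⟨hQ ω, c.agree_of_mem_support σ _ ?_⟩⟩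
  rw [hF, PMF.mem_support_map_iff]
  exact ⟨ω, by simp, rfl⟩

theorem Samples.mono {c : Program} {σ : Memory} {P Q : Ω → Memory → Prop}
    (h : c.Samples σ Ω P) (hPQ : ∀ ω τ, Memory.Agree c.targets σ τ → P ω τ → Q ω τ) :
    c.Samples σ Ω Q := by
  obtain ⟨F, hF, hP⟩ := h.agree
  exact ⟨F, hF, fun ω => hPQ ω _ (hP ω).2 (hP ω).1⟩

theorem samples_flip {a : ℕ} {i : Expr} {σ : Memory} {Q : Bool → Memory → Prop}
    (h : ∀ b : Bool, Q b (σ.write a ⌊i.eval σ⌋₊ (if b then 1 else 0))) :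
    (flip a i).Samples σ Bool Q :=
  ⟨_, law_flip _ _ _, h⟩

theorem Samples.seq_yields {c₁ c₂ : Program} {σ : Memory} {P Q : Ω → Memory → Prop}
    (h₁ : c₁.Samples σ Ω P)
    (h₂ : ∀ ω τ, Memory.Agree c₁.targets σ τ → P ω τ → c₂.Yields τ (Q ω)) :
    (seq c₁ c₂).Samples σ Ω Q := by
  obtain ⟨F, hF, hP⟩ := h₁.agree
  choose F' hF' hQ using fun ω => h₂ ω (F ω) (hP ω).2 (hP ω).1
  refine ⟨F', ?_, hQ⟩
  rw [law_seq, hF, PMF.bind_map, ← PMF.bind_pure_comp]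
  congr 1
  ext1 ω
  exact hF' ω

theorem Yields.seq_samples {c₁ c₂ : Program} {σ : Memory} {P : Memory → Prop}
    {Q : Ω → Memory → Prop} (h₁ : c₁.Yields σ P)
    (h₂ : ∀ τ, Memory.Agree c₁.targets σ τ → P τ → c₂.Samples τ Ω Q) :
    (seq c₁ c₂).Samples σ Ω Q := by
  obtain ⟨τ, hτ, hP, ha⟩ := h₁.agree
  obtain ⟨F, hF, hQ⟩ := h₂ τ ha hP
  exact ⟨F, by rw [law_seq, hτ, PMF.pure_bind, hF], hQ⟩

/-- The rule for a loop whose round consumes a uniform element of `Ω`: after `j` rounds the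
memory is determined by a uniform element of `α j`, where `α (j + 1)` is identified with
`α j × Ω`. -/
theorem samples_loop {α : ℕ → Type} [∀ j, Fintype (α j)] [∀ j, Nonempty (α j)]
    (x₀ : Unique (α 0)) (q : ∀ j, α j × Ω ≃ α (j + 1)) {e : Expr} {c : Program} {σ : Memory}
    (k : ℕ) (I : ∀ j, α j → Memory → Prop) (hk : ⌊e.eval σ⌋₊ = k) (h₀ : I 0 default σ)
    (h : ∀ j < k, ∀ x τ, Memory.Agree c.targets σ τ → I j x τ →
      c.Samples τ Ω fun ω => I (j + 1) (q j (x, ω))) :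
    (loop e c).Samples σ (α k) (I k) := by
  unfold Samples
  rw [law_loop, hk]
  suffices H : ∀ j ≤ k, ∃ F : α j → Memory,
      iterateLaw c.law j σ = (PMF.uniformOfFintype (α j)).map F ∧
        ∀ x, I j x (F x) ∧ Memory.Agree c.targets σ (F x) by
    obtain ⟨F, h₁, h₂⟩ := H k le_rfl
    exact ⟨F, h₁, fun x => (h₂ x).1⟩
  intro j
  induction j with
  | zero =>
    refine fun _ => ⟨fun _ => σ, ?_, fun x => ⟨?_, fun _ _ => rfl⟩⟩
    · rw [iterateLaw]
      exact (PMF.map_const _ _).symm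
    · rwa [Unique.eq_default x]
  | succ j ih =>
    intro hj
    obtain ⟨F, hF, hI⟩ := ih (by omega)
    choose F' hF' hI' using fun x => (h j (by omega) x (F x) (hI x).2 (hI x).1).agree
    refine ⟨fun y => F' ((q j).symm y).1 ((q j).symm y).2, ?_, fun y => ⟨?_, fun a ha => ?_⟩⟩
    · rw [iterateLaw, hF, PMF.bind_map, ← map_uniformOfFintype_equiv (q j), PMF.map_comp]
      have : (c.law ∘ F) = fun x => (PMF.uniformOfFintype Ω).map (F' x) := funext hF'
      rw [this, uniformOfFintype_bind_map]
      congr 1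
      ext1 x
      simp
    · simpa using (hI' ((q j).symm y).1 ((q j).symm y).2).1
    · exact ((hI' _ _).2 a ha).trans ((hI _).2 a ha)

end

end Program

/-! ### Minimum spanning trees and Prim's algorithm -/

/-- If every vertex is joined to the set `S` by edges in `E` and `y` is not in `S`, then `E`
contains an edge leaving `S` that may be dropped when `y` is added to `S`. -/
theorem exists_removable_edge {V : Type} [DecidableEq V] {E : Finset (Sym2 V)} {S : Finset V}
    (hE : ∀ v, ∃ s ∈ S, (SimpleGraph.fromEdgeSet (E : Set (Sym2 V))).Reachable v s) {y : V}
    (hy : y ∉ S) :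
    ∃ a ∈ S, ∃ b ∉ S, s(a, b) ∈ E ∧ ∀ v, ∃ s ∈ insert y S,
      (SimpleGraph.fromEdgeSet ((E.erase s(a, b) : Finset _) : Set (Sym2 V))).Reachable v s := by
  -- follow a walk from `y` until it enters `S` for the first time
  have first : ∀ (u s : V) (p : (SimpleGraph.fromEdgeSet (E : Set (Sym2 V))).Walk u s), s ∈ S →
      u ∉ S → ∃ b, b ∉ S ∧ (∃ a ∈ S, s(a, b) ∈ E) ∧
        Relation.ReflTransGen (fun x z => x ∉ S ∧ z ∉ S ∧ s(x, z) ∈ E ∧ x ≠ z) u b := by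
    intro u s p
    induction p with
    | nil => exact fun h h' => absurd h h'
    | @cons u v w huv p ih =>
      intro hw hu
      rw [SimpleGraph.fromEdgeSet_adj] at huv
      by_cases hv : v ∈ S
      · exact ⟨u, hu, ⟨v, hv, by rw [Sym2.eq_swap]; exact_mod_cast huv.1⟩, .refl⟩
      · obtain ⟨b, hb, hab, hr⟩ := ih hw hv
        exact ⟨b, hb, hab, .head ⟨hu, hv, by exact_mod_cast huv.1, huv.2⟩ hr⟩
  obtain ⟨s, hs, ⟨p⟩⟩ := hE y
  obtain ⟨b, hb, ⟨a, ha, hab⟩, hyb⟩ := first y s p hs hy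
  refine ⟨a, ha, b, hb, hab, fun v => ?_⟩
  set H := SimpleGraph.fromEdgeSet ((E.erase s(a, b) : Finset _) : Set (Sym2 V))
  have hreach : H.Reachable y b := by
    have aux : ∀ z, Relation.ReflTransGen (fun x z => x ∉ S ∧ z ∉ S ∧ s(x, z) ∈ E ∧ x ≠ z) y z →
        H.Reachable y z := by
      intro z hz
      induction hz with
      | refl => exact .refl _
      | @tail x z _ hxz ih =>
        refine ih.trans (SimpleGraph.Adj.reachable ?_)
        rw [SimpleGraph.fromEdgeSet_adj]
        refine ⟨?_, hxz.2.2.2⟩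
        rw [Finset.mem_coe, Finset.mem_erase]
        refine ⟨fun h => ?_, hxz.2.2.1⟩
        have : a ∈ s(x, z) := h ▸ Sym2.mem_mk_left a b
        rcases Sym2.mem_iff.1 this with rfl | rfl
        · exact hxz.1 ha
        · exact hxz.2.1 ha
    exact aux b hyb
  have walk : ∀ (u s : V) (p : (SimpleGraph.fromEdgeSet (E : Set (Sym2 V))).Walk u s), s ∈ S →
      ∃ t ∈ insert y S, H.Reachable u t := by
    intro u s p
    induction p with
    | @nil u => exact fun h => ⟨u, Finset.mem_insert_of_mem h, .refl _⟩
    | @cons u v w huv p ih =>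
      intro hw
      rw [SimpleGraph.fromEdgeSet_adj] at huv
      by_cases he : s(u, v) = s(a, b)
      · have : u ∈ s(a, b) := he ▸ Sym2.mem_mk_left u v
        rcases Sym2.mem_iff.1 this with rfl | rfl
        · exact ⟨u, Finset.mem_insert_of_mem ha, .refl _⟩
        · exact ⟨y, Finset.mem_insert_self _ _, hreach.symm⟩
      · obtain ⟨t, ht, hvt⟩ := ih hw
        refine ⟨t, ht, (SimpleGraph.Adj.reachable ?_).trans hvt⟩
        rw [SimpleGraph.fromEdgeSet_adj]
        exact ⟨by rw [Finset.mem_coe, Finset.mem_erase]; exact ⟨he, by exact_mod_cast huv.1⟩, huv.2⟩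
  obtain ⟨s, hs, ⟨p⟩⟩ := hE v
  exact walk v s p hs

namespace StochasticGraph

variable (G : StochasticGraph)

theorem dist_self (s : Fin G.m) : G.dist s s = 0 := (G.dist_eq_zero s s).2 rfl

theorem dist_nonneg (s t : Fin G.m) : 0 ≤ G.dist s t := by
  have h := G.dist_triangle s t s
  rw [G.dist_self, G.dist_comm t s] at h
  linarith

/-- The node `0`. -/
def root : Fin G.n := ⟨0, G.n_pos⟩

theorem edgeLength_mk (r : Fin G.n → Fin G.m) (u v : Fin G.n) :
    G.edgeLength r s(u, v) = G.dist (r u) (r v) := rfl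

theorem edgeLength_nonneg (r : Fin G.n → Fin G.m) (e : Sym2 (Fin G.n)) :
    (0 : ℝ) ≤ G.edgeLength r e := by
  induction e with
  | h u v => exact_mod_cast G.dist_nonneg _ _

/-- Every node in `S` is joined to the root by the edges in `F`. -/
def Spans (F : Finset (Sym2 (Fin G.n))) (S : Finset (Fin G.n)) : Prop :=
  ∀ v ∈ S, (SimpleGraph.fromEdgeSet (F : Set (Sym2 (Fin G.n)))).Reachable G.root v

open Classical in
theorem mst_le_sum (r : Fin G.n → Fin G.m) {F : Finset (Sym2 (Fin G.n))}
    (hF : G.Spans F Finset.univ) : G.mst r ≤ ∑ e ∈ F, (G.edgeLength r e : ℝ) := by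
  have hconn : (SimpleGraph.fromEdgeSet (F : Set (Sym2 (Fin G.n)))).Connected := by
    have : Nonempty (Fin G.n) := ⟨G.root⟩
    exact ⟨fun u v => (hF u (Finset.mem_univ _)).symm.trans (hF v (Finset.mem_univ _))⟩
  obtain ⟨T, hT, hT'⟩ := hconn.exists_isTree_le
  have hsub : T.edgeFinset ⊆ F := by
    intro e he
    have h := SimpleGraph.edgeSet_mono hT (SimpleGraph.mem_edgeFinset.1 he)
    rw [SimpleGraph.edgeSet_fromEdgeSet] at h
    exact_mod_cast h.1
  calc G.mst r ≤ ∑ e ∈ T.edgeFinset, (G.edgeLength r e : ℝ) := by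
        refine ciInf_le (f := fun T : {T : SimpleGraph (Fin G.n) // T.IsTree} =>
          ∑ e ∈ T.1.edgeFinset, (G.edgeLength r e : ℝ)) ⟨0, ?_⟩ ⟨T, hT'⟩
        rintro _ ⟨T, rfl⟩
        exact Finset.sum_nonneg fun e _ => G.edgeLength_nonneg r e
    _ ≤ _ := Finset.sum_le_sum_of_subset_of_nonneg hsub fun e _ _ => G.edgeLength_nonneg r e

open Classical in
theorem le_mst (r : Fin G.n → Fin G.m) {c : ℝ} (h : ∀ T : SimpleGraph (Fin G.n), T.IsTree →
    c ≤ ∑ e ∈ T.edgeFinset, (G.edgeLength r e : ℝ)) : c ≤ G.mst r := by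
  have : Nonempty (Fin G.n) := ⟨G.root⟩
  obtain ⟨T, -, hT⟩ := (SimpleGraph.connected_top (V := Fin G.n)).exists_isTree_le
  have : Nonempty {T : SimpleGraph (Fin G.n) // T.IsTree} := ⟨⟨T, hT⟩⟩
  exact le_ciInf fun T => h T.1 T.2

theorem mst_nonneg (r : Fin G.n → Fin G.m) : 0 ≤ G.mst r :=
  G.le_mst r fun _ _ => Finset.sum_nonneg fun e _ => G.edgeLength_nonneg r e

open Classical in
/-- The invariant of Prim's algorithm, `S` being the set of the nodes reached and `c` the length
spent so far.  On the one hand, `S` is spanned by edges of total length at most `c`.  On the other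
hand, every tree can be split into a part of length at least `c` and a part that joins every
node to `S`. -/
def PrimInv (r : Fin G.n → Fin G.m) (S : Finset (Fin G.n)) (c : ℚ) : Prop :=
  (∃ F, G.Spans F S ∧ ∑ e ∈ F, (G.edgeLength r e : ℝ) ≤ c) ∧
  ∀ T : SimpleGraph (Fin G.n), T.IsTree → ∃ E ⊆ T.edgeFinset,
    (∀ v, ∃ s ∈ S, (SimpleGraph.fromEdgeSet (E : Set (Sym2 (Fin G.n)))).Reachable v s) ∧
      c + ∑ e ∈ E, (G.edgeLength r e : ℝ) ≤ ∑ e ∈ T.edgeFinset, (G.edgeLength r e : ℝ)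

theorem primInv_root (r : Fin G.n → Fin G.m) : G.PrimInv r {G.root} 0 := by
  refine ⟨⟨∅, fun v hv => ?_, by simp⟩, fun T hT => ⟨_, subset_rfl, fun v => ⟨G.root, by simp, ?_⟩,
    by simp⟩⟩
  · rw [Finset.mem_singleton.1 hv]
  · rw [SimpleGraph.coe_edgeFinset, SimpleGraph.fromEdgeSet_edgeSet]
    exact hT.connected.preconnected v G.root

theorem PrimInv.insert {G : StochasticGraph} {r : Fin G.n → Fin G.m} {S : Finset (Fin G.n)} {c : ℚ}
    (h : G.PrimInv r S c) {x y : Fin G.n} (hx : x ∈ S) (hy : y ∉ S)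
    (hmin : ∀ a ∈ S, ∀ b ∉ S, G.dist (r x) (r y) ≤ G.dist (r a) (r b)) :
    G.PrimInv r (insert y S) (c + G.dist (r x) (r y)) := by
  obtain ⟨⟨F, hF, hFc⟩, hT⟩ := h
  refine ⟨⟨Insert.insert s(x, y) F, fun v hv => ?_, ?_⟩, fun T hTree => ?_⟩
  · have hle : SimpleGraph.fromEdgeSet (F : Set (Sym2 (Fin G.n))) ≤
        SimpleGraph.fromEdgeSet ((Insert.insert s(x, y) F : Finset _) : Set (Sym2 (Fin G.n))) :=
      SimpleGraph.fromEdgeSet_mono (by simp)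
    rcases Finset.mem_insert.1 hv with rfl | hv
    · refine ((hF x hx).mono hle).trans (SimpleGraph.Adj.reachable ?_)
      rw [SimpleGraph.fromEdgeSet_adj]
      exact ⟨by simp, fun h => hy (h ▸ hx)⟩
    · exact (hF v hv).mono hle
  · have h₁ : ∑ e ∈ Insert.insert s(x, y) F, (G.edgeLength r e : ℝ) ≤
        G.edgeLength r s(x, y) + ∑ e ∈ F, (G.edgeLength r e : ℝ) := by
      by_cases hm : s(x, y) ∈ F
      · rw [Finset.insert_eq_of_mem hm]
        linarith [G.edgeLength_nonneg r s(x, y)]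
      · rw [Finset.sum_insert hm]
    rw [edgeLength_mk] at h₁
    push_cast
    linarith
  · obtain ⟨E, hET, hE, hc⟩ := hT T hTree
    obtain ⟨a, ha, b, hb, hab, hE'⟩ := exists_removable_edge hE hy
    refine ⟨E.erase s(a, b), (Finset.erase_subset _ _).trans hET, hE', ?_⟩
    have h₁ := Finset.add_sum_erase E (fun e => (G.edgeLength r e : ℝ)) hab
    simp only [edgeLength_mk] at h₁
    have h₂ : (G.dist (r x) (r y) : ℝ) ≤ G.dist (r a) (r b) := by exact_mod_cast hmin a ha b hb
    push_cast
    linarith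

theorem PrimInv.eq_mst {G : StochasticGraph} {r : Fin G.n → Fin G.m} {c : ℚ}
    (h : G.PrimInv r Finset.univ c) : (c : ℝ) = G.mst r := by
  obtain ⟨⟨F, hF, hFc⟩, hT⟩ := h
  refine le_antisymm (G.le_mst r fun T hTree => ?_) ((G.mst_le_sum r hF).trans hFc)
  obtain ⟨E, -, -, hE⟩ := hT T hTree
  linarith [Finset.sum_nonneg fun e (_ : e ∈ E) => G.edgeLength_nonneg r e]

/-! ### The star at the root -/

/-- The length of the star that joins the root to all nodes. -/
def star (r : Fin G.n → Fin G.m) : ℚ := ∑ v, G.dist (r G.root) (r v)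

theorem star_nonneg (r : Fin G.n → Fin G.m) : 0 ≤ G.star r :=
  Finset.sum_nonneg fun _ _ => G.dist_nonneg _ _

theorem mst_le_star (r : Fin G.n → Fin G.m) : G.mst r ≤ G.star r := by
  have hS : G.Spans (Finset.univ.image fun v => s(G.root, v)) Finset.univ := by
    intro v _
    rcases eq_or_ne G.root v with rfl | hv
    · exact .refl _
    · refine SimpleGraph.Adj.reachable ?_
      rw [SimpleGraph.fromEdgeSet_adj]
      exact ⟨by simp, hv⟩
  refine (G.mst_le_sum r hS).trans ?_
  rw [star, Rat.cast_sum, Finset.sum_image]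
  · rfl
  · intro u _ v _ h
    rcases Sym2.eq_iff.1 h with ⟨-, h⟩ | ⟨h₁, h₂⟩
    · exact h
    · exact h₂.trans h₁

theorem dist_le_mst (r : Fin G.n → Fin G.m) (u v : Fin G.n) :
    (G.dist (r u) (r v) : ℝ) ≤ G.mst r := by
  classical
  refine G.le_mst r fun T hT => ?_
  obtain ⟨p, hp⟩ := (hT.connected.preconnected u v).exists_isPath
  have key : ∀ {u v : Fin G.n} (p : T.Walk u v),
      (G.dist (r u) (r v) : ℝ) ≤ (p.edges.map fun e => (G.edgeLength r e : ℝ)).sum := by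
    intro u v p
    induction p with
    | nil => simp [G.dist_self]
    | @cons u v w h p ih =>
      have h₁ : (G.dist (r u) (r w) : ℝ) ≤ G.dist (r u) (r v) + G.dist (r v) (r w) := by
        exact_mod_cast G.dist_triangle _ _ _
      simp only [SimpleGraph.Walk.edges_cons, List.map_cons, List.sum_cons, edgeLength_mk]
      linarith
  refine (key p).trans ?_
  rw [← List.sum_toFinset _ hp.isTrail.edges_nodup]
  refine Finset.sum_le_sum_of_subset_of_nonneg (fun e he => ?_) fun e _ _ =>
    G.edgeLength_nonneg r e
  rw [SimpleGraph.mem_edgeFinset]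
  exact p.edges_subset_edgeSet (List.mem_toFinset.1 he)

theorem star_le_mul_mst (r : Fin G.n → Fin G.m) : (G.star r : ℝ) ≤ G.n * G.mst r := by
  rw [star, Rat.cast_sum]
  refine (Finset.sum_le_card_nsmul _ _ _ fun v _ => G.dist_le_mst r G.root v).trans ?_
  simp

/-- The ratio of the length of the minimum spanning tree to that of the star at the root, with the
value `0` if all nodes are located at the same point. -/
noncomputable def ratio (r : Fin G.n → Fin G.m) : ℝ := G.mst r / G.star r

theorem ratio_nonneg (r : Fin G.n → Fin G.m) : 0 ≤ G.ratio r :=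
  div_nonneg (G.mst_nonneg r) (by exact_mod_cast G.star_nonneg r)

theorem ratio_le_one (r : Fin G.n → Fin G.m) : G.ratio r ≤ 1 :=
  div_le_one_of_le₀ (G.mst_le_star r) (by exact_mod_cast G.star_nonneg r)

theorem star_mul_ratio (r : Fin G.n → Fin G.m) : G.star r * G.ratio r = G.mst r := by
  rcases eq_or_ne (G.star r : ℝ) 0 with h | h
  · have h₁ := G.mst_le_star r
    rw [h] at h₁ ⊢
    linarith [G.mst_nonneg r]
  · exact mul_div_cancel₀ _ h

end StochasticGraph

/-! ### Resampling and the importance weights -/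

namespace StochasticGraph

variable (G : StochasticGraph)

/-- The probability of a realization. -/
noncomputable def realizationProb (r : Fin G.n → Fin G.m) : ℝ := ∏ v, (G.prob v (r v) : ℝ)

theorem realizationProb_nonneg (r : Fin G.n → Fin G.m) : 0 ≤ G.realizationProb r :=
  Finset.prod_nonneg fun v _ => by exact_mod_cast G.prob_nonneg v (r v)

theorem sum_prob_cast (v : Fin G.n) : ∑ s, (G.prob v s : ℝ) = 1 := by
  exact_mod_cast congrArg (Rat.cast : ℚ → ℝ) (G.prob_sum v)

theorem sum_realizationProb : ∑ r, G.realizationProb r = 1 := by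
  have h := Finset.prod_univ_sum (fun _ : Fin G.n => (Finset.univ : Finset (Fin G.m)))
    fun v s => (G.prob v s : ℝ)
  simp only [sum_prob_cast, Finset.prod_const_one, Fintype.piFinset_univ] at h
  exact h.symm

/-- Relocating the node `v` according to its own distribution does not change the law of the
realization. -/
theorem sum_resample (v : Fin G.n) (h : (Fin G.n → Fin G.m) → ℝ) :
    ∑ s, (G.prob v s : ℝ) * ∑ r, G.realizationProb r * h (Function.update r v s) =
      ∑ r, G.realizationProb r * h r := by
  have key : ∀ (r : Fin G.n → Fin G.m) (s : Fin G.m), (G.prob v s : ℝ) * G.realizationProb r =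
      G.prob v (r v) * G.realizationProb (Function.update r v s) := by
    intro r s
    unfold realizationProb
    rw [← Finset.mul_prod_erase _ _ (Finset.mem_univ v),
      ← Finset.mul_prod_erase _ (fun u => (G.prob u (Function.update r v s u) : ℝ))
        (Finset.mem_univ v), Function.update_self]
    have : ∏ u ∈ Finset.univ.erase v, (G.prob u (Function.update r v s u) : ℝ) =
        ∏ u ∈ Finset.univ.erase v, (G.prob u (r u) : ℝ) :=
      Finset.prod_congr rfl fun u hu => by rw [Function.update_of_ne (Finset.ne_of_mem_erase hu)]
    rw [this]
    ring
  -- exchanging the location of `v` in `r` with `s` is an involution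
  let e : (Fin G.n → Fin G.m) × Fin G.m ≃ (Fin G.n → Fin G.m) × Fin G.m :=
    Function.Involutive.toPerm (fun x => (Function.update x.1 v x.2, x.1 v)) fun x => by simp
  calc ∑ s, (G.prob v s : ℝ) * ∑ r, G.realizationProb r * h (Function.update r v s)
      = ∑ x : (Fin G.n → Fin G.m) × Fin G.m,
          G.prob v (e x).2 * (G.realizationProb (e x).1 * h (e x).1) := by
        rw [Fintype.sum_prod_type, Finset.sum_comm]
        refine Finset.sum_congr rfl fun s _ => ?_
        rw [Finset.mul_sum]
        refine Finset.sum_congr rfl fun r _ => ?_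
        rw [← mul_assoc, key, mul_assoc]
        rfl
    _ = ∑ x : (Fin G.n → Fin G.m) × Fin G.m,
          G.prob v x.2 * (G.realizationProb x.1 * h x.1) :=
        e.sum_comp fun x => (G.prob v x.2 : ℝ) * (G.realizationProb x.1 * h x.1)
    _ = ∑ r, G.realizationProb r * h r := by
        rw [Fintype.sum_prod_type]
        refine Finset.sum_congr rfl fun r _ => ?_
        simp only
        rw [← Finset.sum_mul, sum_prob_cast, one_mul]

/-- The realization `r` with the root relocated to `s` and the node `j` relocated to `t`. -/
def relocate (r : Fin G.n → Fin G.m) (j : Fin G.n) (s t : Fin G.m) : Fin G.n → Fin G.m :=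
  Function.update (Function.update r G.root s) j t

/-- The contribution of the edge from the root to `j` to `weightedSum`. -/
noncomputable def edgeTerm (φ : (Fin G.n → Fin G.m) → ℝ) (r : Fin G.n → Fin G.m) (j : Fin G.n) :
    ℝ :=
  if j = G.root then 0 else
    ∑ s, ∑ t, (G.prob G.root s : ℝ) * G.prob j t * G.dist s t * φ (G.relocate r j s t)

/-- The sum of `φ` over all relocations of the root and of another node, weighted with
the contribution of the pair to the expected length of the star at the root. -/
noncomputable def weightedSum (φ : (Fin G.n → Fin G.m) → ℝ) (r : Fin G.n → Fin G.m) : ℝ :=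
  ∑ j, G.edgeTerm φ r j

/-- Integrating the weighted sum of `φ` amounts to integrating `φ` against the length of
the star. -/
theorem sum_weightedSum (φ : (Fin G.n → Fin G.m) → ℝ) :
    ∑ r, G.realizationProb r * G.weightedSum φ r =
      ∑ r, G.realizationProb r * (G.star r * φ r) := by
  have hj : ∀ j, ∑ r, G.realizationProb r * G.edgeTerm φ r j =
      ∑ r, G.realizationProb r * (G.dist (r G.root) (r j) * φ r) := by
    intro j
    by_cases h : j = G.root
    · subst h
      simp [edgeTerm, G.dist_self]
    · have h' : G.root ≠ j := fun h' => h h'.symm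
      set H : (Fin G.n → Fin G.m) → ℝ := fun r => G.dist (r G.root) (r j) * φ r
      have h₁ : ∀ s t r, H (G.relocate r j s t) = G.dist s t * φ (G.relocate r j s t) := by
        intro s t r
        simp [H, relocate, Function.update_of_ne h']
      have h₂ : ∀ t, ∑ s, (G.prob G.root s : ℝ) * ∑ r, G.realizationProb r *
          H (G.relocate r j s t) = ∑ r, G.realizationProb r * H (Function.update r j t) :=
        fun t => G.sum_resample G.root fun r => H (Function.update r j t)
      refine Eq.trans ?_ (G.sum_resample j H)
      simp only [← h₂, h₁, edgeTerm, if_neg h, Finset.mul_sum]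
      rw [Finset.sum_comm]
      conv_rhs => rw [Finset.sum_comm]
      refine Finset.sum_congr rfl fun s _ => ?_
      rw [Finset.sum_comm]
      refine Finset.sum_congr rfl fun t _ => Finset.sum_congr rfl fun r _ => ?_
      ring
  simp only [weightedSum, star, Finset.mul_sum, Rat.cast_sum, Finset.sum_mul]
  rw [Finset.sum_comm]
  simp only [hj]
  rw [Finset.sum_comm]

/-- The expected length of the star at the root. -/
noncomputable def expectedStar : ℝ := ∑ r, G.realizationProb r * G.star r

theorem expectedMST_eq : G.expectedMST = ∑ r, G.realizationProb r * G.mst r := rfl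

theorem expectedMST_eq_sum_weightedSum :
    G.expectedMST = ∑ r, G.realizationProb r * G.weightedSum G.ratio r := by
  simp only [sum_weightedSum, star_mul_ratio, expectedMST_eq]

theorem weightedSum_one (r : Fin G.n → Fin G.m) :
    G.weightedSum (fun _ => 1) r = G.expectedStar := by
  have h := G.sum_weightedSum fun _ => 1
  -- the summand on the left does not depend on the realization
  have : ∀ r', G.weightedSum (fun _ => 1) r' = G.weightedSum (fun _ => 1) r := fun _ => rfl
  simp only [this, ← Finset.sum_mul, sum_realizationProb, one_mul, mul_one] at h
  exact h

theorem edgeTerm_mono {φ ψ : (Fin G.n → Fin G.m) → ℝ} (h : ∀ r, φ r ≤ ψ r)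
    (r : Fin G.n → Fin G.m) (j : Fin G.n) : G.edgeTerm φ r j ≤ G.edgeTerm ψ r j := by
  unfold edgeTerm
  split_ifs
  · exact le_rfl
  · refine Finset.sum_le_sum fun s _ => Finset.sum_le_sum fun t _ => ?_
    have h₁ : (0 : ℝ) ≤ G.prob G.root s := by exact_mod_cast G.prob_nonneg _ _
    have h₂ : (0 : ℝ) ≤ G.prob j t := by exact_mod_cast G.prob_nonneg _ _
    have h₃ : (0 : ℝ) ≤ G.dist s t := by exact_mod_cast G.dist_nonneg _ _
    have h₄ := h (G.relocate r j s t)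
    gcongr

theorem weightedSum_ratio_nonneg (r : Fin G.n → Fin G.m) : 0 ≤ G.weightedSum G.ratio r := by
  have : G.weightedSum (fun _ => 0) r ≤ G.weightedSum G.ratio r :=
    Finset.sum_le_sum fun j _ => G.edgeTerm_mono (fun r => G.ratio_nonneg r) r j
  simpa [weightedSum, edgeTerm] using this

theorem weightedSum_ratio_le (r : Fin G.n → Fin G.m) :
    G.weightedSum G.ratio r ≤ G.expectedStar := by
  rw [← G.weightedSum_one r]
  exact Finset.sum_le_sum fun j _ => G.edgeTerm_mono (fun r => G.ratio_le_one r) r j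

theorem expectedStar_nonneg : 0 ≤ G.expectedStar :=
  Finset.sum_nonneg fun r _ => mul_nonneg (G.realizationProb_nonneg r)
    (by exact_mod_cast G.star_nonneg r)

theorem expectedMST_nonneg : 0 ≤ G.expectedMST :=
  Finset.sum_nonneg fun r _ => mul_nonneg (G.realizationProb_nonneg r) (G.mst_nonneg r)

theorem expectedMST_le_expectedStar : G.expectedMST ≤ G.expectedStar :=
  Finset.sum_le_sum fun r _ =>
    mul_le_mul_of_nonneg_left (G.mst_le_star r) (G.realizationProb_nonneg r)

theorem expectedStar_le : G.expectedStar ≤ G.n * G.expectedMST := by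
  rw [expectedMST_eq, Finset.mul_sum]
  refine Finset.sum_le_sum fun r _ => ?_
  rw [mul_left_comm]
  exact mul_le_mul_of_nonneg_left (G.star_le_mul_mst r) (G.realizationProb_nonneg r)

end StochasticGraph

/-! ### Sampling by inversion from a uniform grid -/

/-- The cumulative sums of a finite sequence. -/
def cumSum {m : ℕ} (p : Fin m → ℚ) (j : ℕ) : ℚ :=
  ∑ i ∈ Finset.range j, if h : i < m then p ⟨i, h⟩ else 0

theorem cumSum_succ {m : ℕ} (p : Fin m → ℚ) (s : Fin m) :
    cumSum p (s + 1) = cumSum p s + p s := by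
  simp [cumSum, Finset.sum_range_succ]

theorem cumSum_mono {m : ℕ} {p : Fin m → ℚ} (hp : ∀ s, 0 ≤ p s) : Monotone (cumSum p) := by
  refine monotone_nat_of_le_succ fun j => ?_
  rw [cumSum, cumSum, Finset.sum_range_succ]
  split_ifs
  · linarith [hp ⟨j, ‹_›⟩]
  · linarith

theorem cumSum_self {m : ℕ} (p : Fin m → ℚ) : cumSum p m = ∑ s, p s := by
  rw [cumSum, Finset.sum_range]
  simp

/-- The last index `i < j` such that the cumulative sum up to `i` is at most `u`. -/
def scan {m : ℕ} (p : Fin m → ℚ) (u : ℚ) : ℕ → ℕ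
  | 0 => 0
  | j + 1 => if cumSum p j ≤ u then j else scan p u j

theorem scan_spec {m : ℕ} (p : Fin m → ℚ) {u : ℚ} (hu : 0 ≤ u) (j : ℕ) :
    scan p u (j + 1) ≤ j ∧ cumSum p (scan p u (j + 1)) ≤ u ∧
      (scan p u (j + 1) = j ∨ u < cumSum p (scan p u (j + 1) + 1)) := by
  induction j with
  | zero => simp [scan, cumSum, hu]
  | succ j ih =>
    rw [scan]
    split_ifs with h
    · exact ⟨le_rfl, h, Or.inl rfl⟩
    · refine ⟨ih.1.trans (Nat.le_succ j), ih.2.1, Or.inr ?_⟩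
      rcases ih.2.2 with h' | h'
      · rw [h']
        exact not_le.1 h
      · exact h'

theorem scan_lt {m : ℕ} (hm : 0 < m) (p : Fin m → ℚ) (u : ℚ) : scan p u m < m := by
  have : ∀ j, scan p u (j + 1) ≤ j := by
    intro j
    induction j with
    | zero => simp [scan]
    | succ j ih =>
      rw [scan]
      split_ifs
      · exact le_rfl
      · omega
  obtain ⟨j, rfl⟩ := Nat.exists_eq_succ_of_ne_zero hm.ne'
  exact Nat.lt_succ_of_le (this j)

theorem scan_eq_iff {m : ℕ} {p : Fin m → ℚ} (hp : ∀ s, 0 ≤ p s) (hp' : ∑ s, p s = 1) {u : ℚ}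
    (hu : 0 ≤ u) (hu' : u < 1) (s : Fin m) :
    scan p u m = s ↔ cumSum p s ≤ u ∧ u < cumSum p (s + 1) := by
  have hspec : cumSum p (scan p u m) ≤ u ∧ u < cumSum p (scan p u m + 1) := by
    obtain ⟨j, rfl⟩ := Nat.exists_eq_succ_of_ne_zero (Fin.pos s).ne'
    have h := scan_spec p hu j
    refine ⟨h.2.1, ?_⟩
    rcases h.2.2 with h' | h'
    · rw [h', ← Nat.succ_eq_add_one, cumSum_self, hp']
      exact hu'
    · exact h'
  constructor
  · intro h
    rwa [h] at hspec
  · rintro ⟨h₁, h₂⟩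
    rcases lt_trichotomy (scan p u m) (s : ℕ) with h | h | h
    · exact absurd (hspec.2.trans_le ((cumSum_mono hp h).trans h₁)) (lt_irrefl _)
    · exact h
    · exact absurd (h₂.trans_le ((cumSum_mono hp h).trans hspec.1)) (lt_irrefl _)

/-- The index selected by the `k`-th one of the `M` grid points `k / M` of the unit interval. -/
def select {m M : ℕ} (hm : 0 < m) (p : Fin m → ℚ) (k : Fin M) : Fin m :=
  ⟨scan p ((k : ℕ) / (M : ℚ)) m, scan_lt hm p _⟩

/-- Up to at most one grid point, every index is selected as often as it should be. -/
theorem abs_card_select_sub_le {m M : ℕ} (hm : 0 < m) (hM : 0 < M) {p : Fin m → ℚ}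
    (hp : ∀ s, 0 ≤ p s) (hp' : ∑ s, p s = 1) (s : Fin m) :
    |((Finset.univ.filter fun k : Fin M => select hm p k = s).card : ℝ) - M * p s| ≤ 1 := by
  have hM' : (0 : ℚ) < M := by exact_mod_cast hM
  set a : ℚ := cumSum p s
  set b : ℚ := cumSum p (s + 1)
  have hab : b = a + p s := cumSum_succ p s
  have ha : 0 ≤ a := by
    have h := cumSum_mono hp (Nat.zero_le (s : ℕ))
    rwa [show cumSum p 0 = 0 from rfl] at h
  have hb : b ≤ 1 := by
    rw [← hp', ← cumSum_self]
    exact cumSum_mono hp s.2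
  have hcard : (Finset.univ.filter fun k : Fin M => select hm p k = s).card =
      (Finset.Ico ⌈a * M⌉₊ ⌈b * M⌉₊).card := by
    rw [← Finset.card_map Fin.valEmbedding]
    congr 1
    ext k
    simp only [Finset.mem_map, Finset.mem_filter, Finset.mem_univ, true_and, Finset.mem_Ico,
      Fin.valEmbedding_apply, Nat.ceil_le, Nat.lt_ceil]
    have aux : ∀ k : Fin M, select hm p k = s ↔ a * M ≤ (k : ℕ) ∧ ((k : ℕ) : ℚ) < b * M := by
      intro k
      have hk : ((k : ℕ) : ℚ) < M := by exact_mod_cast k.2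
      rw [Fin.ext_iff, select,
        scan_eq_iff hp hp' (by positivity) ((div_lt_one hM').2 hk) s, le_div_iff₀ hM',
        div_lt_iff₀ hM']
    constructor
    · rintro ⟨k, hk, rfl⟩
      exact (aux k).1 hk
    · rintro ⟨h₁, h₂⟩
      have hk : k < M := by
        have : (k : ℚ) < M := h₂.trans_le (by nlinarith)
        exact_mod_cast this
      exact ⟨⟨k, hk⟩, (aux _).2 ⟨h₁, h₂⟩, rfl⟩
  have hle : ⌈a * M⌉₊ ≤ ⌈b * M⌉₊ := Nat.ceil_mono (by nlinarith [hp s])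
  rw [hcard, Nat.card_Ico, Nat.cast_sub hle]
  have h₁ := Nat.le_ceil (a * M)
  have h₂ := Nat.ceil_lt_add_one (a := a * M) (by positivity)
  have h₃ := Nat.le_ceil (b * M)
  have h₄ := Nat.ceil_lt_add_one (a := b * M) (mul_nonneg (by linarith [hp s]) hM'.le)
  have h₅ : b * M = a * M + M * p s := by rw [hab]; ring
  rw [abs_le]
  constructor
  · have : (-1 : ℚ) ≤ ⌈b * M⌉₊ - ⌈a * M⌉₊ - M * p s := by linarith
    exact_mod_cast this
  · have : (⌈b * M⌉₊ : ℚ) - ⌈a * M⌉₊ - M * p s ≤ 1 := by linarith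
    exact_mod_cast this

theorem abs_sum_select_sub_le {m M : ℕ} (hm : 0 < m) (hM : 0 < M) {p : Fin m → ℚ}
    (hp : ∀ s, 0 ≤ p s) (hp' : ∑ s, p s = 1) {g : Fin m → ℝ} (hg : ∀ s, |g s| ≤ 1) :
    |∑ k : Fin M, g (select hm p k) - M * ∑ s, (p s : ℝ) * g s| ≤ m := by
  have h₁ : ∑ k : Fin M, g (select hm p k) =
      ∑ s, ((Finset.univ.filter fun k : Fin M => select hm p k = s).card : ℝ) * g s := by
    rw [← Finset.sum_fiberwise Finset.univ (fun k : Fin M => select hm p k)]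
    refine Finset.sum_congr rfl fun s _ => ?_
    rw [Finset.sum_congr rfl fun k hk => by rw [(Finset.mem_filter.1 hk).2], Finset.sum_const,
      nsmul_eq_mul]
  rw [h₁, Finset.mul_sum, ← Finset.sum_sub_distrib]
  refine (Finset.abs_sum_le_sum_abs _ _).trans ?_
  refine (Finset.sum_le_card_nsmul _ _ 1 fun s _ => ?_).trans (by simp)
  rw [← mul_assoc, ← sub_mul, abs_mul]
  exact mul_le_one₀ (abs_card_select_sub_le hm hM hp hp' s) (abs_nonneg _) (hg s)

theorem sum_fin_cons {n : ℕ} {α : Type} [Fintype α] (F : (Fin (n + 1) → α) → ℝ) :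
    ∑ f, F f = ∑ a, ∑ f, F (Fin.cons a f) := by
  rw [← (Fin.consEquiv fun _ => α).sum_comp, Fintype.sum_prod_type]
  rfl

theorem sum_eq_sum_succ {n k : ℕ} (h : n = k + 1) (f : Fin n → ℝ) (h₀ : f ⟨0, by omega⟩ = 0) :
    ∑ j, f j = ∑ j : Fin k, f ⟨j + 1, by omega⟩ := by
  subst h
  rw [Fin.sum_univ_succ]
  have : f 0 = 0 := h₀
  rw [this, zero_add]
  rfl

/-- The average over independent grid points approximates the expectation under the product
distribution. -/
theorem abs_sum_select_pi_sub_le {m M : ℕ} (hm : 0 < m) (hM : 0 < M) {n : ℕ}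
    {p : Fin n → Fin m → ℚ} (hp : ∀ v s, 0 ≤ p v s) (hp' : ∀ v, ∑ s, p v s = 1)
    {g : (Fin n → Fin m) → ℝ} (hg : ∀ r, |g r| ≤ 1) :
    |(∑ u : Fin n → Fin M, g fun v => select hm (p v) (u v)) / (M : ℝ) ^ n -
      ∑ r, (∏ v, (p v (r v) : ℝ)) * g r| ≤ n * m / M := by
  have hM' : (0 : ℝ) < M := by exact_mod_cast hM
  induction n with
  | zero =>
    have : ∀ r r' : Fin 0 → Fin m, g r = g r' := fun r r' => congrArg g (Subsingleton.elim r r')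
    simpa using sub_eq_zero.2 (this _ _)
  | succ n ih =>
    -- average over all nodes but the first one
    set A : Fin m → ℝ := fun s =>
      (∑ u : Fin n → Fin M, g (Fin.cons s fun v => select hm (p v.succ) (u v))) / (M : ℝ) ^ n
    set B : Fin m → ℝ := fun s => ∑ r, (∏ v, (p v.succ (r v) : ℝ)) * g (Fin.cons s r)
    have hAB : ∀ s, |A s - B s| ≤ n * m / M := fun s =>
      ih (fun v => hp v.succ) (fun v => hp' v.succ) fun r => hg (Fin.cons s r)
    have hA : ∀ s, |A s| ≤ 1 := by
      intro s
      rw [abs_div, abs_of_pos (pow_pos hM' n), div_le_one (pow_pos hM' n)]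
      refine (Finset.abs_sum_le_sum_abs _ _).trans
        ((Finset.sum_le_card_nsmul _ _ 1 fun u _ => hg _).trans ?_)
      simp
    have h₁ : (∑ u : Fin (n + 1) → Fin M, g fun v => select hm (p v) (u v)) / (M : ℝ) ^ (n + 1) =
        (∑ k : Fin M, A (select hm (p 0) k)) / M := by
      rw [sum_fin_cons, pow_succ, ← div_div]
      congr 1
      rw [Finset.sum_div]
      refine Finset.sum_congr rfl fun k _ => ?_
      simp only [A]
      congr 1
      refine Finset.sum_congr rfl fun u _ => ?_
      congr 1
      ext1 v
      refine Fin.cases ?_ (fun v => ?_) v <;> simp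
    have h₂ : ∑ r, (∏ v, (p v (r v) : ℝ)) * g r = ∑ s, (p 0 s : ℝ) * B s := by
      rw [sum_fin_cons]
      refine Finset.sum_congr rfl fun s _ => ?_
      simp only [B, Finset.mul_sum, Fin.prod_univ_succ, Fin.cons_zero, Fin.cons_succ, mul_assoc]
    have h₃ : |(∑ k : Fin M, A (select hm (p 0) k)) / M - ∑ s, (p 0 s : ℝ) * A s| ≤ m / M := by
      have := abs_sum_select_sub_le hm hM (hp 0) (hp' 0) hA
      rw [show (∑ k : Fin M, A (select hm (p 0) k)) / M - ∑ s, (p 0 s : ℝ) * A s =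
        (∑ k : Fin M, A (select hm (p 0) k) - M * ∑ s, (p 0 s : ℝ) * A s) / M by field_simp,
        abs_div, abs_of_pos hM']
      gcongr
    have h₄ : |∑ s, (p 0 s : ℝ) * A s - ∑ s, (p 0 s : ℝ) * B s| ≤ n * m / M := by
      rw [← Finset.sum_sub_distrib]
      have hsum : ∑ s, (p 0 s : ℝ) = 1 := by
        exact_mod_cast congrArg (Rat.cast : ℚ → ℝ) (hp' 0)
      calc |∑ s, ((p 0 s : ℝ) * A s - p 0 s * B s)|
          ≤ ∑ s, |(p 0 s : ℝ) * A s - p 0 s * B s| := Finset.abs_sum_le_sum_abs _ _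
        _ ≤ ∑ s, (p 0 s : ℝ) * (n * m / M) := by
            refine Finset.sum_le_sum fun s _ => ?_
            have : (0 : ℝ) ≤ p 0 s := by exact_mod_cast hp 0 s
            rw [← mul_sub, abs_mul, abs_of_nonneg this]
            exact mul_le_mul_of_nonneg_left (hAB s) this
        _ = n * m / M := by rw [← Finset.sum_mul, hsum, one_mul]
    rw [h₁, h₂]
    refine (abs_sub_le _ (∑ s, (p 0 s : ℝ) * A s) _).trans ((add_le_add h₃ h₄).trans_eq ?_)
    push_cast
    ring

/-! ### Averages of independent samples -/

section
variable {Ω : Type} [Fintype Ω] [Nonempty Ω]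

theorem sum_sum_sub_and_sq_le {X : Ω → ℝ} {μ b : ℝ} (hX : ∀ ω, |X ω - μ| ≤ 1)
    (hb : ∑ ω, (X ω - μ) = Fintype.card Ω * b) (N : ℕ) :
    ∑ x : Fin N → Ω, ∑ i, (X (x i) - μ) = (Fintype.card Ω : ℝ) ^ N * (N * b) ∧
      ∑ x : Fin N → Ω, (∑ i, (X (x i) - μ)) ^ 2 ≤
        (Fintype.card Ω : ℝ) ^ N * (N + N ^ 2 * b ^ 2) := by
  set q : ℝ := (Fintype.card Ω : ℝ)
  have hq : 0 ≤ q := Nat.cast_nonneg _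
  induction N with
  | zero => simp
  | succ N ih =>
    set D : (Fin N → Ω) → ℝ := fun x => ∑ i, (X (x i) - μ)
    have hcard : ∑ _x : Fin N → Ω, (1 : ℝ) = q ^ N := by simp [q]
    have hcard' : ∑ _ω : Ω, (1 : ℝ) = q := by simp [q]
    have hsq : ∑ ω, (X ω - μ) ^ 2 ≤ q := by
      rw [← hcard']
      exact Finset.sum_le_sum fun ω _ => (sq_le_one_iff_abs_le_one _).2 (hX ω)
    constructor
    · rw [sum_fin_cons]
      simp only [Fin.sum_univ_succ, Fin.cons_zero, Fin.cons_succ]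
      calc ∑ ω, ∑ x, (X ω - μ + D x)
          = (∑ ω, (X ω - μ)) * (∑ _x : Fin N → Ω, (1 : ℝ)) +
              (∑ _ω : Ω, (1 : ℝ)) * ∑ x, D x := by
            simp only [Finset.sum_mul_sum, ← Finset.sum_add_distrib, mul_one, one_mul]
        _ = _ := by
            rw [hb, hcard, hcard', ih.1]
            push_cast
            ring
    · rw [sum_fin_cons]
      simp only [Fin.sum_univ_succ, Fin.cons_zero, Fin.cons_succ]
      have hinner : ∀ ω, ∑ x, (X ω - μ + D x) ^ 2 =
          (X ω - μ) ^ 2 * q ^ N + (X ω - μ) * (2 * ∑ x, D x) + 1 * ∑ x, D x ^ 2 := by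
        intro ω
        rw [← hcard, Finset.mul_sum, Finset.mul_sum, Finset.mul_sum, Finset.mul_sum,
          ← Finset.sum_add_distrib, ← Finset.sum_add_distrib]
        exact Finset.sum_congr rfl fun x _ => by ring
      calc ∑ ω, ∑ x, (X ω - μ + D x) ^ 2
          = (∑ ω, (X ω - μ) ^ 2) * q ^ N + (∑ ω, (X ω - μ)) * (2 * ∑ x, D x) +
              (∑ _ω : Ω, (1 : ℝ)) * ∑ x, D x ^ 2 := by
            simp only [hinner, Finset.sum_add_distrib, Finset.sum_mul]
        _ ≤ q * q ^ N + (q * b) * (2 * (q ^ N * (N * b))) +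
              q * (q ^ N * (N + N ^ 2 * b ^ 2)) := by
            rw [hb, hcard', ih.1]
            gcongr
            exact ih.2
        _ = q ^ (N + 1) * (((N + 1 : ℕ) : ℝ) + ((N + 1 : ℕ) : ℝ) ^ 2 * b ^ 2) -
              q * q ^ N * b ^ 2 := by
            push_cast
            ring
        _ ≤ _ := sub_le_self _ (by positivity)

/-- Chebyshev's inequality for the average of `N` independent samples, the mean `μ` being known up
to an error `b`. -/
theorem card_deviation_le {X : Ω → ℝ} {μ b η : ℝ} (hX : ∀ ω, |X ω - μ| ≤ 1)
    (hb : ∑ ω, (X ω - μ) = Fintype.card Ω * b) {N : ℕ} (hN : 0 < N) (hη : 0 < η)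
    (h : 1 / N + b ^ 2 ≤ η ^ 2 / 4)
    [DecidablePred fun x : Fin N → Ω => |(∑ i, X (x i)) / N - μ| ≤ η] :
    (3 / 4 : ℝ) * (Fintype.card Ω : ℝ) ^ N ≤
      (Finset.univ.filter fun x : Fin N → Ω => |(∑ i, X (x i)) / N - μ| ≤ η).card := by
  classical
  have hN' : (0 : ℝ) < N := by exact_mod_cast hN
  set q : ℝ := (Fintype.card Ω : ℝ)
  set good := Finset.univ.filter fun x : Fin N → Ω => |(∑ i, X (x i)) / N - μ| ≤ η
  have hsq := (sum_sum_sub_and_sq_le hX hb N).2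
  have hbad : (goodᶜ.card : ℝ) * (N * η) ^ 2 ≤ q ^ N * (N + N ^ 2 * b ^ 2) := by
    refine le_trans ?_ hsq
    refine le_trans ?_ (Finset.sum_le_sum_of_subset_of_nonneg (Finset.subset_univ goodᶜ)
      fun x _ _ => sq_nonneg _)
    rw [← nsmul_eq_mul]
    refine Finset.card_nsmul_le_sum _ _ _ fun x hx => ?_
    have hx : η < |(∑ i, X (x i)) / N - μ| := by simpa [good] using hx
    have hD : ∑ i, (X (x i) - μ) = N * ((∑ i, X (x i)) / N - μ) := by
      rw [Finset.sum_sub_distrib]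
      simp
      field_simp
    rw [hD, mul_pow, mul_pow, ← sq_abs (_ - μ)]
    gcongr
  have hcard : (good.card : ℝ) + goodᶜ.card = q ^ N := by
    have := Finset.card_add_card_compl good
    rw [Fintype.card_fun, Fintype.card_fin] at this
    calc (good.card : ℝ) + goodᶜ.card = ((Fintype.card Ω ^ N : ℕ) : ℝ) := by exact_mod_cast this
      _ = q ^ N := Nat.cast_pow _ _
  have hbound : (N : ℝ) + N ^ 2 * b ^ 2 ≤ (N * η) ^ 2 / 4 := by
    have := mul_le_mul_of_nonneg_left h (sq_nonneg (N : ℝ))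
    have h₁ : (N : ℝ) ^ 2 * (1 / N + b ^ 2) = N + N ^ 2 * b ^ 2 := by field_simp
    rw [h₁] at this
    linarith
  have hpos : 0 < (N * η) ^ 2 := by positivity
  have : (goodᶜ.card : ℝ) ≤ q ^ N / 4 := by
    have h₁ := hbad.trans (mul_le_mul_of_nonneg_left hbound (by positivity : 0 ≤ q ^ N))
    have h₂ : (goodᶜ.card : ℝ) * (N * η) ^ 2 ≤ q ^ N / 4 * (N * η) ^ 2 := by linarith
    exact le_of_mul_le_mul_right h₂ hpos
  linarith

end

/-! ### Counting loops -/

theorem Memory.write_of_ne {σ : Memory} {a b : ℕ} (h : b ≠ a) (i : ℕ) (q : ℚ) :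
    σ.write a i q b = σ b :=
  Function.update_of_ne h _ _

theorem Memory.write_same (σ : Memory) (a i j : ℕ) (q : ℚ) :
    σ.write a i q a j = if j = i then q else σ a j := by
  simp [Memory.write, Function.update_apply]

/-- The scalar variable kept in cell `0` of array `a`. -/
def Expr.var (a : ℕ) : Expr := .get a (.const 0)

@[simp] theorem Expr.eval_var (a : ℕ) (σ : Memory) : (Expr.var a).eval σ = σ a 0 := by
  simp [Expr.var, Expr.eval]

namespace Program

/-- Assignment to a scalar variable. -/
def assign (a : ℕ) (e : Expr) : Program := set a (.const 0) e

/-- The loop `for i in {0, …, e - 1}`, the scalar `i` being the loop counter. -/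
def forLoop (i : ℕ) (e : Expr) (c : Program) : Program :=
  seq (assign i (.const 0)) (loop e (seq c (assign i (.add (.var i) (.const 1)))))

theorem yields_assign {a : ℕ} {e : Expr} {σ : Memory} {Q : Memory → Prop}
    (h : Q (σ.write a 0 (e.eval σ))) : (assign a e).Yields σ Q :=
  yields_set (by simpa [Expr.eval] using h)

theorem yields_assign_seq {a : ℕ} {e : Expr} {c : Program} {σ : Memory} {Q : Memory → Prop}
    (h : c.Yields (σ.write a 0 (e.eval σ)) Q) : (seq (assign a e) c).Yields σ Q :=
  yields_set_seq (by simpa [Expr.eval] using h)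

theorem agree_cons_of_write {i : ℕ} {l : List ℕ} {σ τ : Memory} {q : ℚ}
    (h : Memory.Agree (l ++ [i]) (σ.write i 0 q) τ) : Memory.Agree (i :: l) σ τ := by
  intro a ha
  simp only [List.mem_cons, not_or] at ha
  rw [h a (by simp [ha]), Memory.write_of_ne ha.1]

/-- The rule for counting loops with an invariant that does not mention the counter. -/
theorem yields_for {i : ℕ} {e : Expr} {c : Program} {σ : Memory} (k : ℕ) (I : ℕ → Memory → Prop)
    (he : e.inputOnly) (hi : i ≠ 0) (hic : i ∉ c.targets) (hk : ⌊e.eval σ⌋₊ = k)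
    (hI : ∀ j τ q, I j τ → I j (τ.write i 0 q)) (h₀ : I 0 σ)
    (h : ∀ j < k, ∀ τ, Memory.Agree (i :: c.targets) σ τ → τ i 0 = j → I j τ →
      c.Yields τ (I (j + 1))) :
    (forLoop i e c).Yields σ fun τ => I k τ ∧ τ i 0 = k := by
  refine yields_assign_seq (yields_loop k (fun j τ => I j τ ∧ τ i 0 = j) ?_ ⟨hI _ _ _ h₀, ?_⟩ ?_)
  · rw [← hk, e.eval_congr_of_inputOnly (Memory.write_of_ne hi.symm _ _) he]
  · simp [Memory.write_same, Expr.eval]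
  · rintro j hj τ ha ⟨hIj, hij⟩
    refine yields_seq (h j hj τ (agree_cons_of_write ha) hij hIj) fun ρ hρ hIρ =>
      yields_assign ⟨hI _ _ _ hIρ, ?_⟩
    simp [Memory.write_same, Expr.eval, hρ i hic, hij]

/-- The rule for counting loops whose rounds are independent experiments with the sample
space `Ω`. -/
theorem samples_for {Ω : Type} [Fintype Ω] [Nonempty Ω] {i : ℕ} {e : Expr} {c : Program}
    {σ : Memory} (k : ℕ) (I : ∀ j, (Fin j → Ω) → Memory → Prop)
    (he : e.inputOnly) (hi : i ≠ 0) (hic : i ∉ c.targets) (hk : ⌊e.eval σ⌋₊ = k)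
    (hI : ∀ j x τ q, I j x τ → I j x (τ.write i 0 q)) (h₀ : ∀ x, I 0 x σ)
    (h : ∀ j < k, ∀ x τ, Memory.Agree (i :: c.targets) σ τ → τ i 0 = j → I j x τ →
      c.Samples τ Ω fun ω => I (j + 1) (Fin.snoc (α := fun _ => Ω) x ω)) :
    (forLoop i e c).Samples σ (Fin k → Ω) fun x τ => I k x τ ∧ τ i 0 = k := by
  refine Yields.seq_samples (P := fun τ => τ = σ.write i 0 0)
    (yields_assign (by simp [Expr.eval])) ?_
  rintro _ - rfl
  refine samples_loop (α := fun j => Fin j → Ω) inferInstance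
    (fun j => (Equiv.prodComm _ _).trans (Fin.snocEquiv fun _ => Ω)) k
    (fun j x τ => I j x τ ∧ τ i 0 = j) ?_ ⟨hI _ _ _ _ (h₀ _), ?_⟩ ?_
  · rw [← hk, e.eval_congr_of_inputOnly (Memory.write_of_ne hi.symm _ _) he]
  · simp [Memory.write_same]
  · rintro j hj x τ ha ⟨hIj, hij⟩
    refine Samples.seq_yields (h j hj x τ (agree_cons_of_write ha) hij hIj) fun ω ρ hρ hIρ =>
      yields_assign ⟨hI _ _ _ _ hIρ, ?_⟩
    simp [Memory.write_same, Expr.eval, hρ i hic, hij]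

/-- The rule for counting loops that accumulate a sum in the scalar `4`. -/
theorem yields_for_sum {i : ℕ} {e : Expr} {c : Program} {σ : Memory} (k : ℕ) (f : Fin k → ℝ)
    (he : e.inputOnly) (hi : i ≠ 0) (hi' : 4 ≠ i) (hic : i ∉ c.targets) (hk : ⌊e.eval σ⌋₊ = k)
    (h : ∀ j : Fin k, ∀ τ, Memory.Agree (i :: c.targets) σ τ → τ i 0 = (j : ℕ) →
      c.Yields τ fun ρ => ((ρ 4 0 : ℚ) : ℝ) = (τ 4 0 : ℚ) + f j) :
    (forLoop i e c).Yields σ fun τ => ((τ 4 0 : ℚ) : ℝ) = (σ 4 0 : ℚ) + ∑ j, f j := by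
  refine (yields_for k (fun j τ => ((τ 4 0 : ℚ) : ℝ) = (σ 4 0 : ℚ) +
    ∑ a ∈ Finset.range j, if ha : a < k then f ⟨a, ha⟩ else 0) he hi hic hk ?_ (by simp) ?_).mono ?_
  · intro j τ q hτ
    rwa [Memory.write_of_ne hi']
  · intro j hj τ ha hτ hI
    refine (h ⟨j, hj⟩ τ ha hτ).mono fun ρ _ hρ => ?_
    rw [hρ, hI, Finset.sum_range_succ, dif_pos hj, add_assoc]
  · rintro τ - ⟨hτ, -⟩
    rw [hτ, Finset.sum_range]
    simp

end Program

/-! ### The algorithm -/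

namespace StochasticGraph

open Program

/-- The number of nodes. -/
def nodesExpr : Expr := .get 0 (.const 0)

/-- The number of points. -/
def pointsExpr : Expr := .get 0 (.const 1)

/-- The expression `1 / ε`. -/
def invEpsExpr : Expr := .div (.const 1) (.get 0 (.const 2))

/-- The number of samples. -/
def samplesExpr : Expr :=
  .mul (.mul (.const 8) (.mul nodesExpr nodesExpr))
    (.mul (.add (.const 1) invEpsExpr) (.add (.const 1) invEpsExpr))

/-- The number of random bits for the location of one node. -/
def bitsExpr : Expr :=
  .add (.add (.add (.add nodesExpr nodesExpr) pointsExpr) (.const 3)) invEpsExpr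

/-- The entry of the distance matrix in the given row and column. -/
def distExpr (e₁ e₂ : Expr) : Expr := .get 1 (.add (.mul e₁ pointsExpr) e₂)

/-- The entry of the matrix of the location probabilities in the given row and column. -/
def probExpr (e₁ e₂ : Expr) : Expr := .get 2 (.add (.mul e₁ pointsExpr) e₂)

/-- Choose a grid point of the unit interval uniformly at random, and store it in the
scalar `5`. -/
def drawProgram : Program :=
  seq (assign 5 (.const 0))
    (loop bitsExpr (seq (flip 8 (.const 0)) (assign 5 (.div (.add (.var 5) (.var 8)) (.const 2)))))

/-- Select a location for the node `9` according to the number in the scalar `5`, by scanning the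
location probabilities, and store it in the scalar `11`. -/
def selectProgram : Program :=
  seq (assign 11 (.const 0))
    (forLoop 10 pointsExpr
      (seq (ite (.const 0) (.var 5) (assign 11 (.var 10)) (assign 11 (.var 11)))
        (assign 5 (.sub (.var 5) (probExpr (.var 9) (.var 10))))))

/-- Sample a realization into array `12`. -/
def sampleProgram : Program :=
  forLoop 9 nodesExpr (seq drawProgram (seq selectProgram (set 12 (.var 9) (.var 11))))

/-- Copy the realization from array `12` to array `16`, relocating the root to the point `14` and
the node whose predecessor is `13` to the point `15`. -/
def relocateProgram : Program :=
  seq (forLoop 17 nodesExpr (set 16 (.var 17) (.get 12 (.var 17))))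
    (seq (set 16 (.const 0) (.var 14)) (set 16 (.add (.var 13) (.const 1)) (.var 15)))

/-- Compute the length of the star at the root, under the realization in array `16`, in the
scalar `7`. -/
def starProgram : Program :=
  seq (assign 7 (.const 0))
    (forLoop 17 nodesExpr
      (assign 7 (.add (.var 7) (distExpr (.get 16 (.const 0)) (.get 16 (.var 17))))))

/-- Compare the edge from the node `21` to the node `22` with the shortest edge found so far,
whose length is kept in the scalar `19` (a negative value meaning that there is none) and whose
endpoint is kept in the scalar `20`.  Array `18` marks the nodes reached by the tree. -/
def scanEdgeProgram : Program :=
  ite (.const 1) (.sub (.get 18 (.var 21)) (.get 18 (.var 22)))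
    (ite (.const 0) (.var 19)
      (ite (.var 19) (distExpr (.get 16 (.var 21)) (.get 16 (.var 22)))
        (assign 20 (.var 20))
        (seq (assign 19 (distExpr (.get 16 (.var 21)) (.get 16 (.var 22))))
          (assign 20 (.var 22))))
      (seq (assign 19 (distExpr (.get 16 (.var 21)) (.get 16 (.var 22))))
        (assign 20 (.var 22))))
    (assign 20 (.var 20))

/-- Find a shortest edge from the nodes reached to the others. -/
def minEdgeProgram : Program :=
  seq (assign 19 (.const (-1))) (forLoop 21 nodesExpr (forLoop 22 nodesExpr scanEdgeProgram))

/-- Prim's algorithm: compute the length of the minimum spanning tree, under the realization in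
array `16`, in the scalar `6`. -/
def primProgram : Program :=
  seq (assign 6 (.const 0))
    (seq (forLoop 17 nodesExpr (set 18 (.var 17) (.const 0)))
      (seq (set 18 (.const 0) (.const 1))
        (loop (.sub nodesExpr (.const 1))
          (seq minEdgeProgram
            (seq (set 18 (.var 20) (.const 1)) (assign 6 (.add (.var 6) (.var 19))))))))

/-- Add the contribution of one relocation to the scalar `4`. -/
def termProgram : Program :=
  seq relocateProgram (seq starProgram (seq primProgram
    (assign 4 (.add (.var 4)
      (.div (.mul (.mul (.mul (probExpr (.const 0) (.var 14))
          (probExpr (.add (.var 13) (.const 1)) (.var 15))) (distExpr (.var 14) (.var 15)))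
        (.var 6)) (.var 7))))))

/-- Add the weighted sum of the ratios over all relocations to the scalar `4`. -/
def weightedSumProgram : Program :=
  forLoop 13 (.sub nodesExpr (.const 1))
    (forLoop 14 pointsExpr (forLoop 15 pointsExpr termProgram))

/-- The approximation scheme: the average of the weighted sums over independent samples. -/
def schemeProgram : Program :=
  seq (forLoop 23 samplesExpr (seq sampleProgram weightedSumProgram))
    (assign 3 (.div (.var 4) (.var 23)))

/-- The levels of the arrays: the input, the counters and marks, the variables computed from them,
and the accumulated result. -/
def level (a : ℕ) : ℕ :=
  if a ≤ 2 then 0 else if a ≤ 4 then 3 else if a ≤ 7 then 2 else 1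

theorem levelled_schemeProgram : schemeProgram.levelled level = true := by decide

end StochasticGraph

/-! ### Correctness of the algorithm -/

namespace StochasticGraph

open Program

variable {G : StochasticGraph} {ε : ℚ}

theorem rowMajor_apply {a b : ℕ} (M : Fin a → Fin b → ℚ) (i : Fin a) (j : Fin b) :
    rowMajor M (i * b + j) = M i j := by
  have h : (i : ℕ) * b + j < a * b := by
    have h₁ : ((i : ℕ) + 1) * b ≤ a * b := Nat.mul_le_mul_right b i.2
    have h₂ := j.2
    rw [add_mul, one_mul] at h₁
    omega
  have h' : (⟨i * b + j, h⟩ : Fin (a * b)) = finProdFinEquiv (i, j) := by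
    apply Fin.ext
    simp only [finProdFinEquiv_apply_val]
    ring
  rw [rowMajor, dif_pos h, h', Equiv.symm_apply_apply]

/-- The arrays `0`, `1`, `2` hold the input. -/
def IsInput (G : StochasticGraph) (ε : ℚ) (σ : Memory) : Prop :=
  ∀ a ≤ 2, σ a = G.load ε a

theorem IsInput.agree {σ τ : Memory} {l : List ℕ} (h : G.IsInput ε σ) (ha : Memory.Agree l σ τ)
    (hl : l.all (2 < ·)) : G.IsInput ε τ := by
  intro a ha'
  rw [← h a ha']
  refine ha a fun hal => ?_
  have := List.all_eq_true.1 hl a hal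
  simp only [decide_eq_true_eq] at this
  omega

theorem IsInput.write {σ : Memory} (h : G.IsInput ε σ) {a : ℕ} (ha : 2 < a) (i : ℕ) (q : ℚ) :
    G.IsInput ε (σ.write a i q) := fun b hb => by
  rw [Memory.write_of_ne (by omega), h b hb]

section
variable {σ : Memory} (hσ : G.IsInput ε σ)
include hσ

theorem IsInput.eval_nodesExpr : nodesExpr.eval σ = G.n := by
  simp [nodesExpr, Expr.eval, hσ 0 (by norm_num), load]

theorem IsInput.eval_pointsExpr : pointsExpr.eval σ = G.m := by
  simp [pointsExpr, Expr.eval, hσ 0 (by norm_num), load]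

theorem IsInput.eval_invEpsExpr : invEpsExpr.eval σ = 1 / ε := by
  simp [invEpsExpr, Expr.eval, hσ 0 (by norm_num), load]

theorem IsInput.eval_distExpr {e₁ e₂ : Expr} (s t : Fin G.m) (h₁ : e₁.eval σ = (s : ℕ))
    (h₂ : e₂.eval σ = (t : ℕ)) : (distExpr e₁ e₂).eval σ = G.dist s t := by
  have h : e₁.eval σ * pointsExpr.eval σ + e₂.eval σ = ((s * G.m + t : ℕ) : ℚ) := by
    rw [h₁, h₂, hσ.eval_pointsExpr]
    push_cast
    ring
  simp only [distExpr, Expr.eval]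
  rw [h, Nat.floor_natCast, hσ 1 (by norm_num)]
  exact rowMajor_apply G.dist s t

theorem IsInput.eval_probExpr {e₁ e₂ : Expr} (v : Fin G.n) (s : Fin G.m)
    (h₁ : e₁.eval σ = (v : ℕ)) (h₂ : e₂.eval σ = (s : ℕ)) :
    (probExpr e₁ e₂).eval σ = G.prob v s := by
  have h : e₁.eval σ * pointsExpr.eval σ + e₂.eval σ = ((v * G.m + s : ℕ) : ℚ) := by
    rw [h₁, h₂, hσ.eval_pointsExpr]
    push_cast
    ring
  simp only [probExpr, Expr.eval]
  rw [h, Nat.floor_natCast, hσ 2 (by norm_num)]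
  exact rowMajor_apply G.prob v s

end

/-- The array `a` holds the realization `r`. -/
def Holds (a : ℕ) (r : Fin G.n → Fin G.m) (σ : Memory) : Prop :=
  ∀ v : Fin G.n, σ a v = (r v : ℕ)

theorem points_pos (G : StochasticGraph) : 0 < G.m := by
  rcases Nat.eq_zero_or_pos G.m with h | h
  · have h₁ := G.prob_sum G.root
    have : IsEmpty (Fin G.m) := by rw [h]; infer_instance
    simp at h₁
  · exact h

theorem Holds.of_eq {a : ℕ} {r : Fin G.n → Fin G.m} {σ τ : Memory} (h : Holds a r σ)
    (hτ : τ a = σ a) : Holds a r τ := fun v => by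
  rw [hτ]
  exact h v

/-- Array `18` marks the elements of `S`. -/
def Marks (S : Finset (Fin G.n)) (σ : Memory) : Prop :=
  ∀ v : Fin G.n, σ 18 v = if v ∈ S then 1 else 0

theorem Marks.of_eq {S : Finset (Fin G.n)} {σ τ : Memory} (h : Marks S σ) (hτ : τ 18 = σ 18) :
    Marks S τ := fun v => by
  rw [hτ]
  exact h v

theorem yields_relocateProgram {σ : Memory} (hσ : G.IsInput ε σ) {r : Fin G.n → Fin G.m}
    (hr : Holds 12 r σ) {j : Fin G.n} {s t : Fin G.m} {i : ℕ} (hij : (j : ℕ) = i + 1)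
    (hj : σ 13 0 = i) (hs : σ 14 0 = (s : ℕ)) (ht : σ 15 0 = (t : ℕ)) :
    relocateProgram.Yields σ (Holds 16 (G.relocate r j s t)) := by
  have hcopy := yields_for (i := 17) (e := nodesExpr)
    (c := set 16 (.var 17) (.get 12 (.var 17))) (σ := σ) G.n
    (fun k τ => ∀ v : Fin G.n, (v : ℕ) < k → τ 16 v = (r v : ℕ)) rfl (by decide) (by decide)
    (by simp [hσ.eval_nodesExpr])
    (fun k τ q h v hv => by rw [Memory.write_of_ne (by decide)]; exact h v hv)
    (fun v hv => absurd hv (Nat.not_lt_zero _)) (by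
      intro k hk τ ha hτ hI
      refine yields_set fun v hv => ?_
      simp only [Expr.eval, Expr.eval_var, hτ, Nat.floor_natCast, Memory.write_same]
      split_ifs with h
      · rw [ha 12 (by decide), ← h, hr v]
      · exact hI v (by omega))
  refine yields_seq hcopy fun τ ha hτ => yields_set_seq (yields_set fun v => ?_)
  have h13 : τ 13 = σ 13 := ha 13 (by decide)
  have h14 : τ 14 = σ 14 := ha 14 (by decide)
  have h15 : τ 15 = σ 15 := ha 15 (by decide)
  have hidx : ⌊(i : ℚ) + 1⌋₊ = i + 1 := by exact_mod_cast Nat.floor_natCast (i + 1)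
  simp only [Expr.eval, Expr.eval_var, Memory.write_same, Memory.write_of_ne (by decide : 13 ≠ 16),
    Memory.write_of_ne (by decide : 15 ≠ 16), h13, h14, h15, hj, hs, ht, hidx, Nat.floor_zero]
  unfold relocate
  by_cases h₁ : v = j
  · subst h₁
    simp [hij]
  · have h₁' : (v : ℕ) ≠ i + 1 := fun h => h₁ (Fin.ext (h.trans hij.symm))
    rw [if_neg h₁', Function.update_of_ne h₁]
    by_cases h₂ : v = G.root
    · subst h₂
      simp [root]
    · have h₂' : (v : ℕ) ≠ 0 := fun h => h₂ (Fin.ext h)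
      rw [if_neg h₂', Function.update_of_ne h₂]
      exact hτ.1 v v.2

theorem yields_starProgram {σ : Memory} (hσ : G.IsInput ε σ) {r : Fin G.n → Fin G.m}
    (hr : Holds 16 r σ) : starProgram.Yields σ fun τ => τ 7 0 = G.star r := by
  refine yields_assign_seq ?_
  have hσ' : G.IsInput ε (σ.write 7 0 ((Expr.const 0).eval σ)) := hσ.write (by norm_num) _ _
  refine (yields_for G.n (fun k τ => τ 7 0 = ∑ v : Fin G.n,
    if (v : ℕ) < k then G.dist (r G.root) (r v) else 0) rfl (by decide) (by decide)
    (by simp [hσ'.eval_nodesExpr])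
    (fun k τ q h => by rw [Memory.write_of_ne (by decide)]; exact h)
    (by simp [Memory.write_same, Expr.eval]) ?_).mono ?_
  · intro k hk τ ha hτ hI
    refine yields_assign ?_
    have hτ' := hσ'.agree ha (by decide)
    have h16 : τ 16 = σ 16 := by
      rw [ha 16 (by decide), Memory.write_of_ne (by decide)]
    rw [Memory.write_same, if_pos rfl]
    simp only [Expr.eval, Expr.eval_var]
    rw [hτ'.eval_distExpr (r G.root) (r ⟨k, hk⟩), hI]
    · have : ∀ v : Fin G.n, (if (v : ℕ) < k + 1 then G.dist (r G.root) (r v) else 0) =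
          (if (v : ℕ) < k then G.dist (r G.root) (r v) else 0) +
            if v = ⟨k, hk⟩ then G.dist (r G.root) (r v) else 0 := by
        intro v
        rcases lt_trichotomy (v : ℕ) k with h | h | h
        · rw [if_pos (by omega), if_pos h, if_neg (fun h' => by simp [h'] at h), add_zero]
        · rw [if_pos (by omega), if_neg (by omega), if_pos (Fin.ext h), zero_add]
        · rw [if_neg (by omega), if_neg (by omega), if_neg (fun h' => by simp [h'] at h), add_zero]
      simp only [this, Finset.sum_add_distrib]
      simp
    · have : σ 16 0 = (r G.root : ℕ) := hr G.root
      simpa [Expr.eval, h16] using this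
    · simpa [Expr.eval, h16, hτ] using hr ⟨k, hk⟩
  · rintro τ - ⟨h, -⟩
    rw [h, star]
    exact Finset.sum_congr rfl fun v _ => if_pos v.2

/-- Among the edges `ab` with `P a b` that leave `S`, the scalars `19` and `20` describe a
shortest one, by its length and its second endpoint; the scalar `19` is negative if there is none. -/
def IsBest (r : Fin G.n → Fin G.m) (S : Finset (Fin G.n)) (P : Fin G.n → Fin G.n → Prop)
    (σ : Memory) : Prop :=
  (σ 19 0 < 0 ∧ ∀ a ∈ S, ∀ b ∉ S, ¬P a b) ∨
    ∃ x ∈ S, ∃ y ∉ S, σ 19 0 = G.dist (r x) (r y) ∧ σ 20 0 = (y : ℕ) ∧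
      ∀ a ∈ S, ∀ b ∉ S, P a b → G.dist (r x) (r y) ≤ G.dist (r a) (r b)

theorem IsBest.congr {r : Fin G.n → Fin G.m} {S : Finset (Fin G.n)}
    {P P' : Fin G.n → Fin G.n → Prop} {σ τ : Memory} (h : IsBest r S P σ)
    (h19 : τ 19 0 = σ 19 0) (h20 : τ 20 0 = σ 20 0) (hP : ∀ a ∈ S, ∀ b ∉ S, P' a b → P a b) :
    IsBest r S P' τ := by
  rcases h with ⟨h₁, h₂⟩ | ⟨x, hx, y, hy, h₁, h₂, h₃⟩
  · exact Or.inl ⟨h19 ▸ h₁, fun a ha b hb h => h₂ a ha b hb (hP a ha b hb h)⟩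
  · exact Or.inr ⟨x, hx, y, hy, h19 ▸ h₁, h20 ▸ h₂, fun a ha b hb h =>
      h₃ a ha b hb (hP a ha b hb h)⟩

theorem yields_scanEdgeProgram {σ : Memory} (hσ : G.IsInput ε σ) {r : Fin G.n → Fin G.m}
    (hr : Holds 16 r σ) {S : Finset (Fin G.n)} (hS : Marks S σ) {P P' : Fin G.n → Fin G.n → Prop}
    (hP : IsBest r S P σ) {x y : Fin G.n} (hx : σ 21 0 = (x : ℕ)) (hy : σ 22 0 = (y : ℕ))
    (hP' : ∀ a b, P' a b → P a b ∨ a = x ∧ b = y) :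
    scanEdgeProgram.Yields σ (IsBest r S P') := by
  have hd : (distExpr (.get 16 (.var 21)) (.get 16 (.var 22))).eval σ = G.dist (r x) (r y) := by
    refine hσ.eval_distExpr _ _ ?_ ?_
    · simpa [Expr.eval, hx] using hr x
    · simpa [Expr.eval, hy] using hr y
  have hmark : (Expr.sub (.get 18 (.var 21)) (.get 18 (.var 22))).eval σ =
      (if x ∈ S then 1 else 0) - if y ∈ S then 1 else 0 := by
    simp [Expr.eval, hx, hy, hS x, hS y]
  -- either the new edge replaces the old one, or the old one is kept
  have hreplace : x ∈ S → y ∉ S → (∀ a ∈ S, ∀ b ∉ S, P a b →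
        G.dist (r x) (r y) ≤ G.dist (r a) (r b)) →
      (seq (assign 19 (distExpr (.get 16 (.var 21)) (.get 16 (.var 22))))
          (assign 20 (.var 22))).Yields σ (IsBest r S P') := by
    intro hxS hyS hmin
    refine yields_assign_seq (yields_assign (Or.inr ⟨x, hxS, y, hyS, ?_, ?_, ?_⟩))
    · rw [Memory.write_of_ne (by decide), Memory.write_same, if_pos rfl, hd]
    · rw [Memory.write_same, if_pos rfl, Expr.eval_var, Memory.write_of_ne (by decide), hy]
    · intro a ha b hb h
      rcases hP' a b h with h | ⟨rfl, rfl⟩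
      · exact hmin a ha b hb h
      · exact le_rfl
  have hkeep : IsBest r S P' σ → (assign 20 (.var 20)).Yields σ (IsBest r S P') := by
    intro h
    refine yields_assign (h.congr ?_ ?_ fun _ _ _ _ => id)
    · rw [Memory.write_of_ne (by decide)]
    · rw [Memory.write_same, if_pos rfl, Expr.eval_var]
  refine yields_ite (fun h => ?_) fun h => ?_
  · rw [hmark] at h
    have hxy : x ∈ S ∧ y ∉ S := by
      by_cases h₁ : x ∈ S <;> by_cases h₂ : y ∈ S <;> simp [h₁, h₂, Expr.eval] at h ⊢
      all_goals norm_num at h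
    refine yields_ite (fun h' => yields_ite (fun h'' => hkeep ?_) fun h'' => ?_) fun h' => ?_
    · rw [Expr.eval_var, hd] at h''
      rw [Expr.eval_var] at h'
      rcases hP with ⟨h₁, -⟩ | ⟨a, ha, b, hb, h₁, h₂, h₃⟩
      · exact absurd h₁ (not_lt.2 h')
      · refine Or.inr ⟨a, ha, b, hb, h₁, h₂, fun a' ha' b' hb' hab => ?_⟩
        rcases hP' a' b' hab with hab | ⟨rfl, rfl⟩
        · exact h₃ a' ha' b' hb' hab
        · rwa [← h₁]
    · rw [Expr.eval_var, hd] at h''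
      rw [Expr.eval_var] at h'
      rcases hP with ⟨h₁, -⟩ | ⟨a, ha, b, hb, h₁, h₂, h₃⟩
      · exact absurd h₁ (not_lt.2 h')
      · refine hreplace hxy.1 hxy.2 fun a' ha' b' hb' hab => ?_
        rw [h₁] at h''
        exact h''.le.trans (h₃ a' ha' b' hb' hab)
    · rw [Expr.eval_var] at h'
      rcases hP with ⟨-, h₁⟩ | ⟨a, ha, b, hb, h₁, -, -⟩
      · exact hreplace hxy.1 hxy.2 fun a' ha' b' hb' hab => absurd hab (h₁ a' ha' b' hb')
      · rw [h₁] at h'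
        exact absurd h' (not_lt.2 (G.dist_nonneg _ _))
  · rw [hmark] at h
    refine hkeep (hP.congr rfl rfl fun a ha b hb hab => ?_)
    rcases hP' a b hab with hab | ⟨rfl, rfl⟩
    · exact hab
    · simp [ha, hb, Expr.eval] at h

theorem yields_minEdgeProgram {σ : Memory} (hσ : G.IsInput ε σ) {r : Fin G.n → Fin G.m}
    (hr : Holds 16 r σ) {S : Finset (Fin G.n)} (hS : Marks S σ) :
    minEdgeProgram.Yields σ (IsBest r S fun _ _ => True) := by
  refine yields_assign_seq ?_
  set σ₁ := σ.write 19 0 ((Expr.const (-1)).eval σ)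
  have hσ₁ : G.IsInput ε σ₁ := hσ.write (by norm_num) _ _
  have hr₁ : Holds 16 r σ₁ := hr.of_eq (Memory.write_of_ne (by decide) _ _)
  have hS₁ : Marks S σ₁ := hS.of_eq (Memory.write_of_ne (by decide) _ _)
  refine (yields_for G.n (fun k => IsBest r S fun a _ => (a : ℕ) < k) rfl (by decide) (by decide)
    (by simp [hσ₁.eval_nodesExpr]) (fun k τ q h => h.congr ?_ ?_ fun _ _ _ _ => id) ?_ ?_).mono ?_
  · rw [Memory.write_of_ne (by decide)]
  · rw [Memory.write_of_ne (by decide)]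
  · refine Or.inl ⟨?_, fun a _ b _ => Nat.not_lt_zero _⟩
    simp [σ₁, Memory.write_same, Expr.eval]
  · intro k hk τ ha hτ hI
    have hσ₂ := hσ₁.agree ha (by decide)
    have hr₂ : Holds 16 r τ := hr₁.of_eq (ha 16 (by decide))
    have hS₂ : Marks S τ := hS₁.of_eq (ha 18 (by decide))
    refine (yields_for G.n (fun l => IsBest r S fun a b => (a : ℕ) < k ∨ (a : ℕ) = k ∧ (b : ℕ) < l)
      rfl (by decide) (by decide) (by simp [hσ₂.eval_nodesExpr])
      (fun k τ q h => h.congr ?_ ?_ fun _ _ _ _ => id) (hI.congr rfl rfl ?_) ?_).mono ?_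
    · rw [Memory.write_of_ne (by decide)]
    · rw [Memory.write_of_ne (by decide)]
    · intro a _ b _ h
      omega
    · intro l hl ρ ha' hρ hI'
      refine yields_scanEdgeProgram (hσ₂.agree ha' (by decide)) (hr₂.of_eq (ha' 16 (by decide)))
        (hS₂.of_eq (ha' 18 (by decide))) hI' (x := ⟨k, hk⟩) (y := ⟨l, hl⟩) ?_ hρ ?_
      · rw [ha' 21 (by decide)]
        exact hτ
      · intro a b h
        simp only [Fin.ext_iff]
        omega
    · rintro ρ - ⟨h, -⟩
      refine h.congr rfl rfl fun a _ b _ h => ?_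
      have := b.2
      omega
  · rintro τ - ⟨h, -⟩
    exact h.congr rfl rfl fun a _ _ _ _ => a.2

theorem yields_primProgram {σ : Memory} (hσ : G.IsInput ε σ) {r : Fin G.n → Fin G.m}
    (hr : Holds 16 r σ) : primProgram.Yields σ fun τ => ((τ 6 0 : ℚ) : ℝ) = G.mst r := by
  refine yields_assign_seq ?_
  set σ₁ := σ.write 6 0 ((Expr.const 0).eval σ)
  have hσ₁ : G.IsInput ε σ₁ := hσ.write (by norm_num) _ _
  have hr₁ : Holds 16 r σ₁ := hr.of_eq (Memory.write_of_ne (by decide) _ _)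
  have h6 : σ₁ 6 0 = 0 := by simp [σ₁, Memory.write_same, Expr.eval]
  have hclear := yields_for (i := 17) (e := nodesExpr) (c := set 18 (.var 17) (.const 0)) (σ := σ₁)
    G.n (fun k τ => ∀ v : Fin G.n, (v : ℕ) < k → τ 18 v = 0) rfl (by decide) (by decide)
    (by simp [hσ₁.eval_nodesExpr])
    (fun k τ q h v hv => by rw [Memory.write_of_ne (by decide)]; exact h v hv)
    (fun v hv => absurd hv (Nat.not_lt_zero _)) (by
      intro k hk τ ha hτ hI
      refine yields_set fun v hv => ?_
      simp only [Expr.eval, Expr.eval_var, hτ, Nat.floor_natCast, Memory.write_same]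
      split_ifs with h
      · rfl
      · exact hI v (by omega))
  refine yields_seq hclear fun τ ha ⟨hτ, _⟩ => yields_set_seq ?_
  have hσ₂ := hσ₁.agree ha (by decide)
  have h6' : τ 6 0 = 0 := by rw [ha 6 (by decide), h6]
  have hr₂ : Holds 16 r τ := hr₁.of_eq (ha 16 (by decide))
  set σ₃ := τ.write 18 ⌊(Expr.const 0).eval τ⌋₊ ((Expr.const 1).eval τ)
  have hσ₃ : G.IsInput ε σ₃ := hσ₂.write (by norm_num) _ _
  have hr₃ : Holds 16 r σ₃ := hr₂.of_eq (Memory.write_of_ne (by decide) _ _)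
  have hS₃ : Marks {G.root} σ₃ := fun v => by
    simp only [σ₃, Memory.write_same, Expr.eval, Nat.floor_zero, Finset.mem_singleton]
    rw [hτ v v.2]
    exact if_congr (by simp [Fin.ext_iff, root]) rfl rfl
  have hn := G.n_pos
  refine (yields_loop (G.n - 1) (fun k ρ => ∃ S : Finset (Fin G.n), S.card = k + 1 ∧ Marks S ρ ∧
    G.PrimInv r S (ρ 6 0)) ?_ ⟨{G.root}, by simp, hS₃, ?_⟩ ?_).mono ?_
  · simp only [Expr.eval, hσ₃.eval_nodesExpr]
    rw [show (G.n : ℚ) - 1 = ((G.n - 1 : ℕ) : ℚ) by rw [Nat.cast_sub hn]; simp,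
      Nat.floor_natCast]
  · rw [show σ₃ 6 = τ 6 from Memory.write_of_ne (by decide) _ _, h6']
    exact G.primInv_root r
  · rintro k hk ρ ha' ⟨S, hcard, hS, hprim⟩
    have hr₄ : Holds 16 r ρ := hr₃.of_eq (ha' 16 (by decide))
    refine yields_seq (yields_minEdgeProgram (hσ₃.agree ha' (by decide)) hr₄ hS) ?_
    intro ξ hξ hbest
    -- as `S` is not everything, some edge leaves it
    have hroot : S.Nonempty := Finset.card_pos.1 (by omega)
    have hne : ∃ b, b ∉ S := by
      by_contra! h
      rw [Finset.eq_univ_of_forall h, Finset.card_univ, Fintype.card_fin] at hcard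
      omega
    obtain ⟨x, hx, y, hy, h₁, h₂, h₃⟩ := hbest.resolve_left fun h => by
      obtain ⟨a, ha⟩ := hroot
      obtain ⟨b, hb⟩ := hne
      exact h.2 a ha b hb trivial
    refine yields_set_seq (yields_assign ⟨insert y S, ?_, fun v => ?_, ?_⟩)
    · rw [Finset.card_insert_of_notMem hy, hcard]
    · have h18 : ξ 18 v = if v ∈ S then 1 else 0 := by
        rw [hξ 18 (by decide)]
        exact hS v
      rw [Memory.write_of_ne (by decide), Memory.write_same, Expr.eval_var, h₂, Nat.floor_natCast,
        h18]
      by_cases hvy : v = y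
      · simp [hvy, Expr.eval]
      · have : (v : ℕ) ≠ y := fun h => hvy (Fin.ext h)
        simp [hvy, this]
    · have h6'' : ξ 6 0 = ρ 6 0 := by rw [hξ 6 (by decide)]
      simp only [Memory.write_same, if_true, Expr.eval, Expr.eval_var,
        Memory.write_of_ne (by decide : 6 ≠ 18), Memory.write_of_ne (by decide : 19 ≠ 18), h6'', h₁]
      exact hprim.insert hx hy fun a ha b hb => h₃ a ha b hb trivial
  · rintro ρ - ⟨S, hcard, -, hprim⟩
    have : S = Finset.univ := by
      rw [← Finset.card_eq_iff_eq_univ, Fintype.card_fin, hcard]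
      omega
    subst this
    exact hprim.eq_mst

end StochasticGraph

namespace StochasticGraph

open Program

variable {G : StochasticGraph} {ε : ℚ}

/-! ### The weighted sum of ratios -/

theorem yields_termProgram {σ : Memory} (hσ : G.IsInput ε σ) {r : Fin G.n → Fin G.m}
    (hr : Holds 12 r σ) {j : Fin G.n} {s t : Fin G.m} {i : ℕ} (hij : (j : ℕ) = i + 1)
    (hj : σ 13 0 = i) (hs : σ 14 0 = (s : ℕ)) (ht : σ 15 0 = (t : ℕ)) :
    termProgram.Yields σ fun τ => ((τ 4 0 : ℚ) : ℝ) = (σ 4 0 : ℚ) +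
      (G.prob G.root s : ℝ) * G.prob j t * G.dist s t * G.ratio (G.relocate r j s t) := by
  refine yields_seq (yields_relocateProgram hσ hr hij hj hs ht) fun σ₁ h₁ hr₁ => ?_
  have hσ₁ := hσ.agree h₁ (by decide)
  refine yields_seq (yields_starProgram hσ₁ hr₁) fun σ₂ h₂ hstar => ?_
  have hσ₂ := hσ₁.agree h₂ (by decide)
  refine yields_seq (yields_primProgram hσ₂ (hr₁.of_eq (h₂ 16 (by decide)))) fun σ₃ h₃ hmst => ?_
  have hσ₃ := hσ₂.agree h₃ (by decide)
  refine yields_assign ?_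
  have e4 : σ₃ 4 = σ 4 := by rw [h₃ 4 (by decide), h₂ 4 (by decide), h₁ 4 (by decide)]
  have e13 : σ₃ 13 = σ 13 := by rw [h₃ 13 (by decide), h₂ 13 (by decide), h₁ 13 (by decide)]
  have e14 : σ₃ 14 = σ 14 := by rw [h₃ 14 (by decide), h₂ 14 (by decide), h₁ 14 (by decide)]
  have e15 : σ₃ 15 = σ 15 := by rw [h₃ 15 (by decide), h₂ 15 (by decide), h₁ 15 (by decide)]
  have e7 : σ₃ 7 = σ₂ 7 := h₃ 7 (by decide)
  have k₁ : (Expr.var 14).eval σ₃ = (s : ℕ) := by rw [Expr.eval_var, e14, hs]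
  have k₂ : (Expr.var 15).eval σ₃ = (t : ℕ) := by rw [Expr.eval_var, e15, ht]
  have k₃ : (Expr.add (.var 13) (.const 1)).eval σ₃ = (j : ℕ) := by
    simp [Expr.eval, e13, hj, hij]
  have k₄ : (Expr.const 0).eval σ₃ = ((G.root : Fin G.n) : ℕ) := by simp [Expr.eval, root]
  rw [Memory.write_same, if_pos rfl, Expr.eval, Expr.eval, Expr.eval, Expr.eval, Expr.eval,
    hσ₃.eval_probExpr _ _ k₄ k₁, hσ₃.eval_probExpr _ _ k₃ k₂, hσ₃.eval_distExpr _ _ k₁ k₂]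
  simp only [Expr.eval_var, e4, e7, hstar]
  push_cast
  rw [hmst, ratio]
  ring

theorem yields_weightedSumProgram {σ : Memory} (hσ : G.IsInput ε σ) {r : Fin G.n → Fin G.m}
    (hr : Holds 12 r σ) : weightedSumProgram.Yields σ fun τ =>
      ((τ 4 0 : ℚ) : ℝ) = (σ 4 0 : ℚ) + G.weightedSum G.ratio r := by
  have hn : G.n = G.n - 1 + 1 := (Nat.sub_add_cancel G.n_pos).symm
  have hsum : G.weightedSum G.ratio r =
      ∑ i : Fin (G.n - 1), G.edgeTerm G.ratio r ⟨i + 1, by omega⟩ :=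
    sum_eq_sum_succ hn _ (if_pos rfl)
  rw [hsum]
  refine yields_for_sum _ _ rfl (by decide) (by decide) (by decide) ?_ ?_
  · simp only [Expr.eval, hσ.eval_nodesExpr]
    rw [show (G.n : ℚ) - 1 = ((G.n - 1 : ℕ) : ℚ) by rw [Nat.cast_sub G.n_pos]; simp,
      Nat.floor_natCast]
  intro i σ₁ h₁ hi
  have hσ₁ := hσ.agree h₁ (by decide)
  have hr₁ : Holds 12 r σ₁ := hr.of_eq (h₁ 12 (by decide))
  have hne : (⟨i + 1, by omega⟩ : Fin G.n) ≠ G.root := fun h => by simp [root] at h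
  rw [edgeTerm, if_neg hne]
  refine yields_for_sum _ _ rfl (by decide) (by decide) (by decide)
    (by rw [hσ₁.eval_pointsExpr, Nat.floor_natCast]) fun s σ₂ h₂ hs => ?_
  have hσ₂ := hσ₁.agree h₂ (by decide)
  have hr₂ : Holds 12 r σ₂ := hr₁.of_eq (h₂ 12 (by decide))
  refine yields_for_sum _ _ rfl (by decide) (by decide) (by decide)
    (by rw [hσ₂.eval_pointsExpr, Nat.floor_natCast]) fun t σ₃ h₃ ht => ?_
  refine yields_termProgram (hσ₂.agree h₃ (by decide)) (hr₂.of_eq (h₃ 12 (by decide)))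
    (i := i) rfl ?_ ?_ ht
  · rw [h₃ 13 (by decide), h₂ 13 (by decide), hi]
  · rw [h₃ 14 (by decide), hs]

/-! ### Sampling a realization -/

/-- The number of random bits used for the location of a node. -/
def bitCount (G : StochasticGraph) (ε : ℚ) : ℕ := ⌊(G.n + G.n + G.m + 3 + 1 / ε : ℚ)⌋₊

/-- The number of samples. -/
def sampleCount (G : StochasticGraph) (ε : ℚ) : ℕ :=
  ⌊(8 * (G.n * G.n) * ((1 + 1 / ε) * (1 + 1 / ε)) : ℚ)⌋₊

/-- Appending a most significant bit to a `j`-bit number. -/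
def appendBit (j : ℕ) : Fin (2 ^ j) × Bool ≃ Fin (2 ^ (j + 1)) :=
  (Equiv.prodComm _ _).trans (((finTwoEquiv.symm.prodCongr (Equiv.refl _)).trans
    finProdFinEquiv).trans (finCongr (by rw [pow_succ, mul_comm])))

theorem appendBit_val (j : ℕ) (k : Fin (2 ^ j)) (b : Bool) :
    ((appendBit j (k, b) : Fin (2 ^ (j + 1))) : ℕ) = k + 2 ^ j * if b then 1 else 0 := by
  cases b <;> simp [appendBit, finTwoEquiv]

theorem samples_drawProgram {σ : Memory} (hσ : G.IsInput ε σ) :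
    drawProgram.Samples σ (Fin (2 ^ G.bitCount ε)) fun k τ =>
      τ 5 0 = (k : ℕ) / ((2 ^ G.bitCount ε : ℕ) : ℚ) := by
  refine Yields.seq_samples (P := fun τ => τ 5 0 = 0 ∧ G.IsInput ε τ)
    (yields_assign ⟨by simp [Memory.write_same, Expr.eval], hσ.write (by norm_num) _ _⟩) ?_
  rintro τ - ⟨h5, hτ⟩
  refine samples_loop (α := fun j => Fin (2 ^ j)) (inferInstanceAs (Unique (Fin 1))) appendBit _
    (fun j k τ => τ 5 0 = (k : ℕ) / ((2 ^ j : ℕ) : ℚ)) ?_ ?_ ?_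
  · simp only [bitsExpr, Expr.eval, hτ.eval_nodesExpr, hτ.eval_pointsExpr, hτ.eval_invEpsExpr]
    rfl
  · rw [h5]
    simp
  · intro j _ k ρ _ hρ
    refine (samples_flip (Q := fun b ξ => ξ = ρ.write 8 0 (if b then 1 else 0)) fun b => by
      simp [Expr.eval]).seq_yields ?_
    rintro b _ - rfl
    refine yields_assign ?_
    rw [Memory.write_same, if_pos rfl, appendBit_val]
    simp only [Expr.eval, Expr.eval_var, Memory.write_of_ne (by decide : 5 ≠ 8), hρ,
      Memory.write_same, if_true]
    push_cast
    field_simp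
    ring

theorem yields_selectProgram {σ : Memory} (hσ : G.IsInput ε σ) (v : Fin G.n)
    (hv : σ 9 0 = (v : ℕ)) : selectProgram.Yields σ fun τ =>
      τ 11 0 = (scan (G.prob v) (σ 5 0) G.m : ℕ) := by
  refine yields_assign_seq ?_
  set σ₁ := σ.write 11 0 ((Expr.const 0).eval σ)
  have hσ₁ : G.IsInput ε σ₁ := hσ.write (by norm_num) _ _
  have h5 : σ₁ 5 = σ 5 := Memory.write_of_ne (by decide) _ _
  have h9 : σ₁ 9 = σ 9 := Memory.write_of_ne (by decide) _ _
  have h11 : σ₁ 11 0 = 0 := by simp [σ₁, Memory.write_same, Expr.eval]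
  refine (yields_for G.m (fun k τ => τ 5 0 = σ 5 0 - cumSum (G.prob v) k ∧
    τ 11 0 = (scan (G.prob v) (σ 5 0) k : ℕ)) rfl (by decide) (by decide)
    (by rw [hσ₁.eval_pointsExpr, Nat.floor_natCast]) ?_ ?_ ?_).mono fun τ _ h => h.1.2
  · intro k τ q h
    rwa [Memory.write_of_ne (by decide), Memory.write_of_ne (by decide)]
  · rw [h5, h11]
    simp [cumSum, scan]
  · rintro k hk τ ha hτ ⟨hI5, hI11⟩
    have hτ' := hσ₁.agree ha (by decide)
    have hτ9 : τ 9 0 = (v : ℕ) := by rw [ha 9 (by decide), h9, hv]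
    refine yields_seq (P := fun ρ => ρ 11 0 = (scan (G.prob v) (σ 5 0) (k + 1) : ℕ) ∧
      ∀ a, a ≠ 11 → ρ a = τ a) ?_ ?_
    · refine yields_ite (fun h => yields_assign ⟨?_, fun a ha => Memory.write_of_ne ha _ _⟩)
        fun h => yields_assign ⟨?_, fun a ha => Memory.write_of_ne ha _ _⟩
      · rw [Memory.write_same, if_pos rfl, Expr.eval_var, hτ, scan, if_pos]
        simpa [Expr.eval, hI5] using h
      · rw [Memory.write_same, if_pos rfl, Expr.eval_var, hI11, scan, if_neg]
        simpa [Expr.eval, hI5] using h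
    · rintro ρ - ⟨hρ11, hρ⟩
      have hρ' : G.IsInput ε ρ := fun a ha => by rw [hρ a (by omega), hτ' a ha]
      refine yields_assign ⟨?_, by rwa [Memory.write_of_ne (by decide)]⟩
      rw [Memory.write_same, if_pos rfl, Expr.eval, hρ'.eval_probExpr v ⟨k, hk⟩,
        Expr.eval_var, hρ 5 (by decide), hI5, cumSum_succ (G.prob v) ⟨k, hk⟩]
      · ring
      · rw [Expr.eval_var, hρ 9 (by decide), hτ9]
      · rw [Expr.eval_var, hρ 10 (by decide), hτ]

/-- The realization that is determined by a choice of grid points. -/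
def sampled (G : StochasticGraph) {M : ℕ} (x : Fin G.n → Fin M) (v : Fin G.n) : Fin G.m :=
  select G.points_pos (G.prob v) (x v)

theorem samples_sampleProgram {σ : Memory} (hσ : G.IsInput ε σ) :
    sampleProgram.Samples σ (Fin G.n → Fin (2 ^ G.bitCount ε)) fun x τ =>
      Holds 12 (G.sampled x) τ := by
  refine (samples_for G.n (fun j (x : Fin j → Fin (2 ^ G.bitCount ε)) τ =>
    ∀ (i : Fin j) (hi : (i : ℕ) < G.n), τ 12 i =
      (select G.points_pos (G.prob ⟨i, hi⟩) (x i) : ℕ)) rfl (by decide) (by decide)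
    (by rw [hσ.eval_nodesExpr, Nat.floor_natCast]) ?_ (fun x i => i.elim0) ?_).mono
    fun x τ _ h v => h.1 v v.2
  · intro j x τ q h i hi
    rw [Memory.write_of_ne (by decide)]
    exact h i hi
  · intro j hj x τ ha hτ hI
    have hτ' := hσ.agree ha (by decide)
    refine (samples_drawProgram hτ').seq_yields fun k ρ hρ h5 => ?_
    have hρ' := hτ'.agree hρ (by decide)
    have hρ9 : ρ 9 0 = j := by rw [hρ 9 (by decide), hτ]
    refine yields_seq (yields_selectProgram hρ' ⟨j, hj⟩ hρ9) fun ξ hξ h11 => yields_set ?_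
    have hξ9 : ξ 9 0 = j := by rw [hξ 9 (by decide), hρ9]
    have hξ12 : ξ 12 = τ 12 := by rw [hξ 12 (by decide), hρ 12 (by decide)]
    intro i hi
    rw [Expr.eval_var, Expr.eval_var, hξ9, Nat.floor_natCast, Memory.write_same]
    refine Fin.lastCases (fun hi => ?_) (fun i hi => ?_) i hi
    · rw [if_pos (by simp), h11, h5, Fin.snoc_last]
      rfl
    · rw [if_neg (by simpa using i.2.ne), Fin.snoc_castSucc, hξ12]
      exact hI i hi

theorem samples_schemeProgram (G : StochasticGraph) (ε : ℚ) :
    schemeProgram.Samples (G.load ε)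
      (Fin (G.sampleCount ε) → Fin G.n → Fin (2 ^ G.bitCount ε)) fun x τ =>
        ((τ 3 0 : ℚ) : ℝ) =
          (∑ i, G.weightedSum G.ratio (G.sampled (x i))) / (G.sampleCount ε : ℝ) := by
  have hload : G.IsInput ε (G.load ε) := fun _ _ => rfl
  refine (samples_for (Ω := Fin G.n → Fin (2 ^ G.bitCount ε)) (G.sampleCount ε)
    (fun j x τ => ((τ 4 0 : ℚ) : ℝ) = ∑ i, G.weightedSum G.ratio (G.sampled (x i)))
    rfl (by decide) (by decide) ?_ ?_ ?_ ?_).seq_yields ?_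
  · simp only [samplesExpr, Expr.eval, hload.eval_nodesExpr, hload.eval_invEpsExpr]
    rfl
  · intro j x τ q h
    rwa [Memory.write_of_ne (by decide)]
  · intro x
    simp [load]
  · intro j _ x τ ha hτ hI
    have hτ' := hload.agree ha (by decide)
    refine (samples_sampleProgram hτ').seq_yields fun y ρ hρ hr => ?_
    refine (yields_weightedSumProgram (hτ'.agree hρ (by decide)) hr).mono fun ξ _ hξ => ?_
    rw [hξ, hρ 4 (by decide), hI, Fin.sum_univ_castSucc]
    simp
  · rintro x τ - ⟨hτ, hN⟩
    refine yields_assign ?_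
    rw [Memory.write_same, if_pos rfl]
    simp only [Expr.eval, Expr.eval_var, hN]
    push_cast
    rw [hτ]

end StochasticGraph

/-! ### The accuracy of averages of bounded relative range -/

/-- If `Z` has values in `[0, W]` and its mean is close to a number `f` of size at least `W / n`,
then the average of `N` independent copies of `Z` has a small error relative to `f` with
probability at least `3 / 4`. -/
theorem card_accurate_le {Ω : Type} [Fintype Ω] [Nonempty Ω] {Z : Ω → ℝ} {W f n ε : ℝ} {N : ℕ}
    (hZ : ∀ ω, 0 ≤ Z ω) (hZW : ∀ ω, Z ω ≤ W) (hf : 0 ≤ f) (hfW : f ≤ W) (hWf : W ≤ n * f)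
    (hn : 1 ≤ n) (hε : 0 < ε) (hN : 8 * n ^ 2 / ε ^ 2 ≤ N)
    (hmean : |(∑ ω, Z ω) / (Fintype.card Ω : ℝ) - f| ≤ ε / (4 * n) * W)
    [DecidablePred fun x : Fin N → Ω =>
      (1 - ε) * f ≤ (∑ i, Z (x i)) / N ∧ (∑ i, Z (x i)) / N ≤ (1 + ε) * f] :
    (3 / 4 : ℝ) * Fintype.card (Fin N → Ω) ≤ (Finset.univ.filter fun x : Fin N → Ω =>
      (1 - ε) * f ≤ (∑ i, Z (x i)) / N ∧ (∑ i, Z (x i)) / N ≤ (1 + ε) * f).card := by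
  classical
  have hn₀ : 0 < n := by linarith
  rcases (hf.trans hfW).eq_or_lt with hW | hW
  · -- the sample is constantly `0`, and so is `f`
    have hf0 : f = 0 := le_antisymm (hfW.trans hW.ge) hf
    have hZ0 : ∀ r, Z r = 0 := fun r => le_antisymm ((hZW r).trans hW.ge) (hZ r)
    rw [Finset.filter_true_of_mem, Finset.card_univ]
    · have : (0 : ℝ) ≤ Fintype.card (Fin N → Ω) := Nat.cast_nonneg _
      linarith
    · intro x _
      simp [hf0, hZ0]
  · have hN₀ : (0 : ℝ) < N := lt_of_lt_of_le (by positivity) hN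
    have hq : (0 : ℝ) < Fintype.card Ω := by exact_mod_cast Fintype.card_pos
    -- pass to the variable `Z / W`, which has values in `[0, 1]`
    have hX0 : ∀ ω, 0 ≤ Z ω / W := fun ω => div_nonneg (hZ ω) hW.le
    have hX1 : ∀ ω, Z ω / W ≤ 1 := fun ω => div_le_one_of_le₀ (hZW ω) hW.le
    have hμ0 : 0 ≤ f / W := div_nonneg hf hW.le
    have hμ1 : f / W ≤ 1 := div_le_one_of_le₀ hfW hW.le
    obtain ⟨b, hb⟩ : ∃ b, b = ((∑ ω, Z ω) / (Fintype.card Ω : ℝ) - f) / W := ⟨_, rfl⟩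
    have hsum : ∑ ω, (Z ω / W - f / W) = Fintype.card Ω * b := by
      rw [Finset.sum_sub_distrib, Finset.sum_const, Finset.card_univ, nsmul_eq_mul,
        ← Finset.sum_div, hb]
      field_simp
    have hbias : |b| ≤ ε / (4 * n) := by
      rwa [hb, abs_div, abs_of_pos hW, div_le_iff₀ hW]
    have hvar : 1 / (N : ℝ) + b ^ 2 ≤ (ε / n) ^ 2 / 4 := by
      have h₁ : 1 / (N : ℝ) ≤ ε ^ 2 / (8 * n ^ 2) := by
        rw [div_le_div_iff₀ hN₀ (by positivity), one_mul]
        rw [div_le_iff₀ (by positivity)] at hN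
        linarith
      have h₂ : b ^ 2 ≤ (ε / (4 * n)) ^ 2 :=
        sq_le_sq' (by linarith [(abs_le.1 hbias).1]) (abs_le.1 hbias).2
      have h₃ : (ε / (4 * n)) ^ 2 = ε ^ 2 / (8 * n ^ 2) / 2 := by
        field_simp
        norm_num
      have h₄ : (ε / n) ^ 2 / 4 = 2 * (ε ^ 2 / (8 * n ^ 2)) := by
        field_simp
        norm_num
      have h₅ : 0 ≤ ε ^ 2 / (8 * n ^ 2) := by positivity
      linarith
    have hmain := card_deviation_le (X := fun ω => Z ω / W) (N := N) (η := ε / n)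
      (fun ω => abs_le.2 ⟨by linarith [hX0 ω], by linarith [hX1 ω]⟩) hsum (by exact_mod_cast hN₀)
      (by positivity) hvar
    refine le_trans (le_of_eq ?_) (hmain.trans (Nat.cast_le.2 (Finset.card_le_card ?_)))
    · rw [Fintype.card_fun, Fintype.card_fin, Nat.cast_pow]
    · intro x hx
      rw [Finset.mem_filter] at hx ⊢
      refine ⟨Finset.mem_univ _, ?_⟩
      have h₁ : (∑ i, Z (x i) / W) / N - f / W = ((∑ i, Z (x i)) / N - f) / W := by
        rw [← Finset.sum_div]
        ring
      have h₂ : |(∑ i, Z (x i)) / N - f| ≤ ε * f := by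
        have h₃ := hx.2
        rw [h₁, abs_div, abs_of_pos hW, div_le_iff₀ hW] at h₃
        refine h₃.trans ?_
        rw [div_mul_eq_mul_div, div_le_iff₀ hn₀, mul_assoc, mul_comm f]
        exact mul_le_mul_of_nonneg_left hWf hε.le
      rw [abs_le] at h₂
      constructor <;> linarith [h₂.1, h₂.2]

namespace StochasticGraph

open Program

variable {G : StochasticGraph} {ε : ℚ}

/-! ### The accuracy of the algorithm -/

theorem le_sampleCount (G : StochasticGraph) (hε : 0 < ε) :
    8 * (G.n : ℝ) ^ 2 / (ε : ℝ) ^ 2 ≤ G.sampleCount ε := by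
  have hn : (1 : ℚ) ≤ G.n := by exact_mod_cast G.n_pos
  have h₁ := Nat.lt_floor_add_one (8 * (G.n * G.n) * ((1 + 1 / ε) * (1 + 1 / ε)) : ℚ)
  -- the summand `1` of `1 + 1 / ε` makes up for rounding down
  have h₂ : 8 * (G.n : ℚ) ^ 2 / ε ^ 2 + 1 ≤ 8 * (G.n * G.n) * ((1 + 1 / ε) * (1 + 1 / ε)) := by
    have h₃ : 8 * ((G.n : ℚ) * G.n) * ((1 + 1 / ε) * (1 + 1 / ε)) =
        8 * (G.n : ℚ) ^ 2 / ε ^ 2 + 16 * (G.n : ℚ) ^ 2 / ε + 8 * (G.n : ℚ) ^ 2 := by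
      field_simp
      ring
    have h₄ : 0 ≤ 16 * (G.n : ℚ) ^ 2 / ε := by positivity
    nlinarith
  have h₅ : 8 * (G.n : ℚ) ^ 2 / ε ^ 2 ≤ G.sampleCount ε := by
    unfold sampleCount
    linarith
  exact_mod_cast h₅

theorem le_two_pow_bitCount (G : StochasticGraph) (hε : 0 < ε) :
    4 * (G.n : ℝ) ^ 2 * G.m / ε ≤ ((2 ^ G.bitCount ε : ℕ) : ℝ) := by
  have hcount : G.bitCount ε = G.n + G.n + G.m + 3 + ⌊1 / ε⌋₊ := by
    have h : (G.n + G.n + G.m + 3 + 1 / ε : ℚ) = 1 / ε + ((G.n + G.n + G.m + 3 : ℕ) : ℚ) := by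
      push_cast
      ring
    rw [bitCount, h, Nat.floor_add_natCast (by positivity)]
    ring
  have h₁ : (1 / ε : ℝ) ≤ 2 ^ (⌊1 / ε⌋₊ + 1) := by
    have h₂ : 1 / ε < ((⌊1 / ε⌋₊ + 1 : ℕ) : ℚ) := by
      push_cast
      exact Nat.lt_floor_add_one _
    have h₃ : ((⌊1 / ε⌋₊ + 1 : ℕ) : ℚ) < ((2 ^ (⌊1 / ε⌋₊ + 1) : ℕ) : ℚ) := by
      exact_mod_cast Nat.lt_two_pow_self
    exact_mod_cast (h₂.trans h₃).le
  have hn : (G.n : ℝ) ≤ 2 ^ G.n := by exact_mod_cast Nat.lt_two_pow_self.le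
  have hm : (G.m : ℝ) ≤ 2 ^ G.m := by exact_mod_cast Nat.lt_two_pow_self.le
  have hε' : (0 : ℝ) < ε := by exact_mod_cast hε
  calc 4 * (G.n : ℝ) ^ 2 * G.m / ε = 4 * (G.n * G.n) * G.m * (1 / ε) := by ring
    _ ≤ 4 * (2 ^ G.n * 2 ^ G.n) * 2 ^ G.m * 2 ^ (⌊1 / ε⌋₊ + 1) := by gcongr
    _ = ((2 ^ G.bitCount ε : ℕ) : ℝ) := by
      rw [hcount]
      push_cast
      ring

/-- The average over the grid points is close enough to the expected length of the minimum
spanning tree. -/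
theorem abs_average_sub_expectedMST_le (G : StochasticGraph) (hε : 0 < ε) {M : ℕ}
    (hM : 4 * (G.n : ℝ) ^ 2 * G.m / ε ≤ M) :
    |(∑ u : Fin G.n → Fin M, G.weightedSum G.ratio (G.sampled u)) /
        (Fintype.card (Fin G.n → Fin M) : ℝ) - G.expectedMST| ≤
      ε / (4 * G.n) * G.expectedStar := by
  have hε' : (0 : ℝ) < ε := by exact_mod_cast hε
  have hn : (1 : ℝ) ≤ G.n := by exact_mod_cast G.n_pos
  have hm : (1 : ℝ) ≤ G.m := by exact_mod_cast G.points_pos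
  have hM₀ : (0 : ℝ) < M := lt_of_lt_of_le (by positivity) hM
  have hbound : (G.n * G.m / M : ℝ) ≤ ε / (4 * G.n) := by
    rw [div_le_div_iff₀ hM₀ (by positivity)]
    rw [div_le_iff₀ hε'] at hM
    linarith
  rw [Fintype.card_fun, Fintype.card_fin, Fintype.card_fin, Nat.cast_pow]
  rcases G.expectedStar_nonneg.eq_or_lt with hW | hW
  · have hf0 : G.expectedMST = 0 :=
      le_antisymm (G.expectedMST_le_expectedStar.trans hW.ge) G.expectedMST_nonneg
    have hZ0 : ∀ r, G.weightedSum G.ratio r = 0 := fun r =>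
      le_antisymm ((G.weightedSum_ratio_le r).trans hW.ge) (G.weightedSum_ratio_nonneg r)
    simp [hf0, hZ0, ← hW]
  · have h := abs_sum_select_pi_sub_le G.points_pos (by exact_mod_cast hM₀) G.prob_nonneg
      G.prob_sum (M := M) (g := fun r => G.weightedSum G.ratio r / G.expectedStar) fun r => by
        rw [abs_of_nonneg (div_nonneg (G.weightedSum_ratio_nonneg r) hW.le)]
        exact div_le_one_of_le₀ (G.weightedSum_ratio_le r) hW.le
    have h₁ : ∑ r : Fin G.n → Fin G.m, (∏ v, (G.prob v (r v) : ℝ)) *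
        (G.weightedSum G.ratio r / G.expectedStar) = G.expectedMST / G.expectedStar := by
      simp only [expectedMST_eq_sum_weightedSum, Finset.sum_div, mul_div_assoc]
      rfl
    rw [h₁, ← Finset.sum_div, div_right_comm, ← sub_div, abs_div, abs_of_pos hW,
      div_le_iff₀ hW] at h
    exact h.trans (mul_le_mul_of_nonneg_right hbound hW.le)

theorem schemeProgram_accurate (G : StochasticGraph) (hε : 0 < ε) :
    (3 / 4 : ℝ≥0∞) ≤ (schemeProgram.run (G.load ε)).toOuterMeasure
      {z | (1 - (ε : ℝ)) * G.expectedMST ≤ (z.1 3 0 : ℝ) ∧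
        (z.1 3 0 : ℝ) ≤ (1 + (ε : ℝ)) * G.expectedMST} := by
  classical
  obtain ⟨F, hF, hQ⟩ := samples_schemeProgram G ε
  set S : Set Memory := {τ | (1 - (ε : ℝ)) * G.expectedMST ≤ (τ 3 0 : ℝ) ∧
        (τ 3 0 : ℝ) ≤ (1 + (ε : ℝ)) * G.expectedMST}
  have h₁ : (schemeProgram.run (G.load ε)).toOuterMeasure (Prod.fst ⁻¹' S) =
      (schemeProgram.law (G.load ε)).toOuterMeasure S := by
    rw [law, PMF.toOuterMeasure_map_apply]
  change _ ≤ (schemeProgram.run (G.load ε)).toOuterMeasure (Prod.fst ⁻¹' S)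
  rw [h₁, hF, PMF.toOuterMeasure_map_apply, PMF.toOuterMeasure_uniformOfFintype_apply]
  have h₂ := card_accurate_le (N := G.sampleCount ε)
    (Z := fun u : Fin G.n → Fin (2 ^ G.bitCount ε) => G.weightedSum G.ratio (G.sampled u))
    (fun _ => G.weightedSum_ratio_nonneg _) (fun _ => G.weightedSum_ratio_le _)
    G.expectedMST_nonneg G.expectedMST_le_expectedStar G.expectedStar_le
    (by exact_mod_cast G.n_pos) (by exact_mod_cast hε : (0 : ℝ) < ε) (G.le_sampleCount hε)
    (G.abs_average_sub_expectedMST_le hε (G.le_two_pow_bitCount hε))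
  have h₃ : Fintype.card (F ⁻¹' S) = (Finset.univ.filter fun x :
      Fin (G.sampleCount ε) → Fin G.n → Fin (2 ^ G.bitCount ε) =>
        (1 - (ε : ℝ)) * G.expectedMST ≤
            (∑ i, G.weightedSum G.ratio (G.sampled (x i))) / (G.sampleCount ε : ℝ) ∧
          (∑ i, G.weightedSum G.ratio (G.sampled (x i))) / (G.sampleCount ε : ℝ) ≤
            (1 + (ε : ℝ)) * G.expectedMST).card := by
    rw [Fintype.card_subtype]
    congr 1
    ext x
    simp only [Finset.mem_filter, Finset.mem_univ, true_and, Set.mem_preimage, S, Set.mem_ofPred_eq,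
      hQ]
  rw [← h₃] at h₂
  set q := Fintype.card (Fin (G.sampleCount ε) → Fin G.n → Fin (2 ^ G.bitCount ε))
  have hq : (q : ℝ≥0∞) ≠ 0 := Nat.cast_ne_zero.2 Fintype.card_ne_zero
  rw [ENNReal.le_div_iff_mul_le (Or.inl hq) (Or.inl (ENNReal.natCast_ne_top _))]
  have h₄ : 3 * q ≤ 4 * Fintype.card (F ⁻¹' S) := by
    have : (3 : ℝ) * q ≤ 4 * Fintype.card (F ⁻¹' S) := by linarith
    exact_mod_cast this
  have h₅ : (3 : ℝ≥0∞) * q ≤ 4 * Fintype.card (F ⁻¹' S) := by exact_mod_cast h₄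
  rw [mul_comm, ← mul_div_assoc, mul_comm (q : ℝ≥0∞)]
  exact ENNReal.div_le_of_le_mul (by rwa [mul_comm _ (4 : ℝ≥0∞)])

/-! ### The running time of the algorithm -/

theorem bitLength_dist_le (G : StochasticGraph) (s t : Fin G.m) :
    bitLength (G.dist s t) ≤ ∑ s, ∑ t, bitLength (G.dist s t) :=
  (Finset.single_le_sum (f := fun t => bitLength (G.dist s t)) (fun _ _ => Nat.zero_le _)
    (Finset.mem_univ t)).trans (Finset.single_le_sum (f := fun s => ∑ t, bitLength (G.dist s t))
      (fun _ _ => Nat.zero_le _) (Finset.mem_univ s))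

theorem bitLength_prob_le (G : StochasticGraph) (v : Fin G.n) (s : Fin G.m) :
    bitLength (G.prob v s) ≤ ∑ v, ∑ s, bitLength (G.prob v s) :=
  (Finset.single_le_sum (f := fun s => bitLength (G.prob v s)) (fun _ _ => Nat.zero_le _)
    (Finset.mem_univ s)).trans (Finset.single_le_sum (f := fun v => ∑ s, bitLength (G.prob v s))
      (fun _ _ => Nat.zero_le _) (Finset.mem_univ v))

theorem mul_le_size (G : StochasticGraph) : G.n * G.m ≤ G.size := by
  have : ∑ _v : Fin G.n, ∑ _s : Fin G.m, 1 ≤ ∑ v, ∑ s, bitLength (G.prob v s) :=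
    Finset.sum_le_sum fun v _ => Finset.sum_le_sum fun s _ => bitLength_pos _
  simp only [Finset.sum_const, Finset.card_univ, Fintype.card_fin, smul_eq_mul, mul_one] at this
  exact this.trans (Nat.le_add_left _ _)

theorem n_le_size (G : StochasticGraph) : G.n ≤ G.size :=
  (Nat.le_mul_of_pos_right _ G.points_pos).trans G.mul_le_size

theorem m_le_size (G : StochasticGraph) : G.m ≤ G.size :=
  (Nat.le_mul_of_pos_left _ G.n_pos).trans G.mul_le_size

theorem height_load_le (G : StochasticGraph) (ε : ℚ) (a i : ℕ) :
    height (G.load ε a i) ≤ G.size + bitLength ε := by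
  have hsize : G.size = bitLength G.n + bitLength G.m + ∑ s, ∑ t, bitLength (G.dist s t) +
    ∑ v, ∑ s, bitLength (G.prob v s) := rfl
  have h0 : height 0 ≤ G.size + bitLength ε := by
    have := bitLength_pos ε
    rw [height_zero]
    omega
  have hrow : ∀ {a b : ℕ} (M : Fin a → Fin b → ℚ) (B : ℕ), (∀ i j, bitLength (M i j) ≤ B) →
      B ≤ G.size → ∀ k, height (rowMajor M k) ≤ G.size + bitLength ε := by
    intro a b M B hM hB k
    unfold rowMajor
    split_ifs with h
    · have h₁ := height_le_bitLength (M (finProdFinEquiv.symm ⟨k, h⟩).1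
        (finProdFinEquiv.symm ⟨k, h⟩).2)
      have h₂ := hM (finProdFinEquiv.symm ⟨k, h⟩).1 (finProdFinEquiv.symm ⟨k, h⟩).2
      omega
    · exact h0
  match a, i with
  | 0, 0 =>
    have := height_le_bitLength (G.n : ℚ)
    change height (G.n : ℚ) ≤ _
    omega
  | 0, 1 =>
    have := height_le_bitLength (G.m : ℚ)
    change height (G.m : ℚ) ≤ _
    omega
  | 0, 2 =>
    have := height_le_bitLength ε
    change height ε ≤ _
    omega
  | 0, _ + 3 => exact h0
  | 1, k => exact hrow G.dist _ G.bitLength_dist_le (by omega) k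
  | 2, k => exact hrow G.prob _ G.bitLength_prob_le (by omega) k
  | _ + 3, _ => exact h0

/-- A bound for the numbers of rounds of all loops, in terms of a bound for the numbers of nodes and
points and for `1 / ε`. -/
theorem loopsLe_schemeProgram (G : StochasticGraph) (ε : ℚ) {Y : ℕ} (hn : G.n ≤ Y)
    (hm : G.m ≤ Y) (hε : 0 < ε) (hY : 1 / ε ≤ Y) :
    schemeProgram.loopsLe (G.load ε) (8 * (Y * Y) * ((1 + Y) * (1 + Y)) + (4 * Y + 3)) := by
  set R := 8 * (Y * Y) * ((1 + Y) * (1 + Y)) + (4 * Y + 3) with hR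
  have hload : G.IsInput ε (G.load ε) := fun _ _ => rfl
  have hYR : Y ≤ R := by omega
  have hn' : (G.n : ℚ) ≤ Y := by exact_mod_cast hn
  have hm' : (G.m : ℚ) ≤ Y := by exact_mod_cast hm
  have hε₀ : 0 ≤ 1 / ε := by positivity
  have h₁ : ⌊nodesExpr.eval (G.load ε)⌋₊ ≤ R := by
    rw [hload.eval_nodesExpr, Nat.floor_natCast]
    omega
  have h₂ : ⌊pointsExpr.eval (G.load ε)⌋₊ ≤ R := by
    rw [hload.eval_pointsExpr, Nat.floor_natCast]
    omega
  have h₃ : ⌊(Expr.sub nodesExpr (.const 1)).eval (G.load ε)⌋₊ ≤ R := by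
    refine le_trans (Nat.floor_mono ?_) h₁
    simp [Expr.eval]
  have h₄ : ⌊samplesExpr.eval (G.load ε)⌋₊ ≤ R := by
    refine Nat.floor_le_of_le ?_
    simp only [samplesExpr, Expr.eval, hload.eval_nodesExpr, hload.eval_invEpsExpr]
    calc (8 * (G.n * G.n) * ((1 + 1 / ε) * (1 + 1 / ε)) : ℚ)
        ≤ 8 * (Y * Y) * ((1 + Y) * (1 + Y)) := by gcongr
      _ ≤ R := by
        rw [hR]
        push_cast
        have : (0 : ℚ) ≤ Y := Nat.cast_nonneg _
        linarith
  have h₅ : ⌊bitsExpr.eval (G.load ε)⌋₊ ≤ R := by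
    refine Nat.floor_le_of_le ?_
    simp only [bitsExpr, Expr.eval, hload.eval_nodesExpr, hload.eval_pointsExpr,
      hload.eval_invEpsExpr]
    calc (G.n + G.n + G.m + 3 + 1 / ε : ℚ) ≤ Y + Y + Y + 3 + Y := by gcongr
      _ ≤ R := by
        rw [hR]
        push_cast
        have : (0 : ℚ) ≤ 8 * (Y * Y) * ((1 + Y) * (1 + Y)) := by positivity
        linarith
  simp only [schemeProgram, sampleProgram, weightedSumProgram, drawProgram, selectProgram,
    termProgram, relocateProgram, starProgram, primProgram, minEdgeProgram, scanEdgeProgram,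
    forLoop, assign, loopsLe, h₁, h₂, h₃, h₄, h₅, and_self]

theorem exists_time_bound : ∃ C k : ℕ, ∀ (G : StochasticGraph) (ε : ℚ), 0 < ε →
    ∀ z ∈ (schemeProgram.run (G.load ε)).support,
      (z.2 : ℝ) ≤ C * ((G.size : ℝ) + bitLength ε + 1 / (ε : ℝ)) ^ k := by
  have hlevel : ∀ a, level a ≤ 3 := by
    intro a
    unfold level
    split_ifs <;> omega
  obtain ⟨f, hf, htime⟩ := schemeProgram.exists_polyBounded_time hlevel levelled_schemeProgram
  -- the bound as a function of `Y`, the input length plus `1 / ε`, rounded up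
  have hR : PolyBounded fun Y => 8 * (Y * Y) * ((1 + Y) * (1 + Y)) + (4 * Y + 3) :=
    .add (.mul (.mul (.const 8) (.mul .id .id))
      (.mul (.add (.const 1) .id) (.add (.const 1) .id))) (.add (.mul (.const 4) .id) (.const 3))
  obtain ⟨C, k, hC⟩ := hf.comp hR
  refine ⟨C * 3 ^ k, k, fun G ε hε z hz => ?_⟩
  have hε' : (0 : ℝ) < ε := by exact_mod_cast hε
  set y : ℝ := (G.size : ℝ) + bitLength ε + 1 / (ε : ℝ)
  set Y := ⌈y⌉₊
  have hsize : (0 : ℝ) ≤ G.size := Nat.cast_nonneg _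
  have hbit : (1 : ℝ) ≤ bitLength ε := by exact_mod_cast bitLength_pos ε
  have hinv : (0 : ℝ) < 1 / (ε : ℝ) := by positivity
  have hyY : y ≤ Y := Nat.le_ceil y
  have hlen : G.size + bitLength ε ≤ Y := by
    have : ((G.size + bitLength ε : ℕ) : ℝ) ≤ Y := by
      push_cast
      linarith
    exact_mod_cast this
  have hεY : 1 / ε ≤ Y := by
    have : (1 / (ε : ℝ)) ≤ Y := by linarith
    exact_mod_cast this
  have h₁ := htime (8 * (Y * Y) * ((1 + Y) * (1 + Y)) + (4 * Y + 3)) (G.load ε)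
    (G.loopsLe_schemeProgram ε (G.n_le_size.trans (by omega)) (G.m_le_size.trans (by omega)) hε hεY)
    (fun a i => (G.height_load_le ε a i).trans (by omega)) z hz
  have h₂ : z.2 ≤ C * (Y + 1) ^ k := h₁.trans (hC Y)
  have h₃ : ((Y : ℝ) + 1) ≤ 3 * y := by
    have := Nat.ceil_lt_add_one (a := y) (by linarith)
    linarith
  calc (z.2 : ℝ) ≤ C * ((Y : ℝ) + 1) ^ k := by exact_mod_cast h₂
    _ ≤ C * (3 * y) ^ k := by gcongr
    _ = (C * 3 ^ k : ℕ) * y ^ k := by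
      push_cast
      rw [mul_pow, mul_assoc]

end StochasticGraph

theorem mainTheorem1 :
    ∃ A : Program,
      IsFPRAS StochasticGraph.load StochasticGraph.size StochasticGraph.expectedMST A :=
  ⟨StochasticGraph.schemeProgram, fun G _ hε => G.schemeProgram_accurate hε,
    StochasticGraph.exists_time_bound⟩
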